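/- **Theorem 1.** Let $\alpha\in(0,1)$, $\theta>-\alpha$, let $l\ge 1$ be an integer, and let $\nu$ be a nonatomic probability measure on a Polish space $\mathbb X$. Let $(X_i)_{i\ge1}$ be a sequence of $\mathbb X$-valued random variables from the Ewens–Pitman sampling model, i.e. $X_1\sim\nu$ and, for every $i\ge1$, the conditional distribution of $X_{i+1}$ given $X_1,\dots,X_i$ is $$\frac{\theta+j\alpha}{\theta+i}\,\nu+\frac1{\theta+i}\sum_{r=1}^{j}(n_r-\alpha)\,\delta_{X_r^*},$$ where $X_1^*,\dots,X_j^*$ are the distinct values among $X_1,\dots,X_i$ and $n_1,\dots,n_j$ their frequencies. Let $M_{l,n}$ be the number of distinct values of frequency exactly $l$ among $X_1,\dots,X_n$ (the number of blocks of frequency $l$ of the induced random partition). For $\lambda>0$ and $0<\varepsilon<1/l$ put $$h_1(\lambda)=\lambda+\log\frac{e^\lambda-1}{e^\lambda}+\log\frac{\alpha\,(1-\alpha)_{(l-1)}}{\alpha^\alpha\,l!},\qquad h_2(\varepsilon)=l\log\frac{1-(l-\alpha)\varepsilon}{1-l\varepsilon}+\alpha\log\frac{\varepsilon}{1-(l-\alpha)\varepsilon},$$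 where $(x)_{(m)}=x(x+1)\cdots(x+m-1)$. Then $h_2$ is a bijection from $(0,1/l)$ onto $\mathbb R$. Set $\Lambda_{\alpha,l}(\lambda)=0$ for $\lambda\le0$ and $$\Lambda_{\alpha,l}(\lambda)=\log\left(1+\frac{\alpha\,h_2^{-1}(h_1(\lambda))}{1-l\,h_2^{-1}(h_1(\lambda))}\right)\quad(\lambda>0),\qquad I_l^\alpha(x)=\sup_{\lambda\in\mathbb R}\{\lambda x-\Lambda_{\alpha,l}(\lambda)\}\in[0,+\infty].$$ Then: 1. $\lim_{n\to\infty}\frac1n\log\mathbb E[e^{\lambda M_{l,n}}]=\Lambda_{\alpha,l}(\lambda)$ for every $\lambda\in\mathbb R$. 2. As $n\to\infty$, $n^{-1}M_{l,n}$ satisfies a large deviation principle on $\mathbb R$ with speed $n$ and good rate function $I_l^\alpha$; in particular the rate function does not depend on $\theta$. 3. $I_l^\alpha(0)=0$, $I_l^\alpha(x)<+\infty$ for $x\in(0,1/l]$, and $I_l^\alpha(x)=+\infty$ for $x\notin[0,1/l]$. 4. For Lebesgue-almost every $x>0$, $$\lim_{n\to\infty}\frac1n\log\mathbb P\left[\frac{M_{l,n}}n>x\right]=-I_l^\alpha(x),$$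 with the convention $\log 0=-\infty$. -/

import Mathlib

open MeasureTheory ProbabilityTheory Filter Topology Set
open scoped ENNReal

/-!
## Large deviation principles
-/

/-- A good rate function: nonnegative (possibly `+∞`), lower semicontinuous, with compact
sublevel sets. -/
structure IsGoodRateFunction {E : Type*} [TopologicalSpace E] (I : E → EReal) : Prop where
  nonneg : ∀ x, 0 ≤ I x
  lowerSemicontinuous : LowerSemicontinuous I
  isCompact_sublevel : ∀ c : ℝ, IsCompact {x | I x ≤ (c : EReal)}

/-- The random variables `Z n` satisfy a large deviation principle with speed `a n` and
rate function `I`. Logarithms are extended-real valued, with `log 0 = -∞`. -/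
structure SatisfiesLDP {Ω E : Type*} [MeasurableSpace Ω] [TopologicalSpace E]
    (P : Measure Ω) (Z : ℕ → Ω → E) (a : ℕ → ℝ) (I : E → EReal) : Prop where
  speed : Tendsto a atTop atTop
  upper_bound : ∀ F : Set E, IsClosed F →
    limsup (fun n => ENNReal.log (P {ω | Z n ω ∈ F}) / ((a n : ℝ) : EReal)) atTop
      ≤ -(⨅ x ∈ F, I x)
  lower_bound : ∀ G : Set E, IsOpen G →
    -(⨅ x ∈ G, I x)
      ≤ liminf (fun n => ENNReal.log (P {ω | Z n ω ∈ G}) / ((a n : ℝ) : EReal)) atTop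

/-!
## The Ewens–Pitman sampling model
-/

section EwensPitman

variable {𝕏 : Type*}

/-- The frequency of the value `v` in the sample `x`. -/
noncomputable def sampleFreq {n : ℕ} (x : Fin n → 𝕏) (v : 𝕏) : ℕ :=
  Nat.card {k : Fin n // x k = v}

open Classical in
/-- The distinct values in the sample `x`; they index the blocks of the partition induced by
the sample. -/
noncomputable def distinctValues {n : ℕ} (x : Fin n → 𝕏) : Finset 𝕏 :=
  Finset.univ.image x

/-- The number of blocks with frequency `l` in the partition induced by the sample `x`. -/
noncomputable def blockCount {n : ℕ} (l : ℕ) (x : Fin n → 𝕏) : ℕ :=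
  ((distinctValues x).filter (fun v => sampleFreq x v = l)).card

lemma sampleFreq_eq_sum {n : ℕ} (x : Fin n → 𝕏) (v : 𝕏) [DecidableEq 𝕏] :
    sampleFreq x v = ∑ k, if x k = v then 1 else 0 := by
  simp [sampleFreq, Fintype.card_subtype]

open Classical in
lemma sum_distinctValues {M : Type*} [AddCommMonoid M] {n : ℕ} (x : Fin n → 𝕏) (f : 𝕏 → M) :
    ∑ v ∈ distinctValues x, f v = ∑ k, if (∀ j, j < k → x j ≠ x k) then f (x k) else 0 := by
  rw [← Finset.sum_filter]
  symm
  refine Finset.sum_bij (fun k _ => x k) ?_ ?_ ?_ ?_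
  · intro k _
    simp [distinctValues]
  · intro k hk j hj h
    simp only [Finset.mem_filter, Finset.mem_univ, true_and] at hk hj
    rcases lt_trichotomy k j with h' | h' | h'
    · exact absurd h (hj k h')
    · exact h'
    · exact absurd h.symm (hk j h')
  · intro v hv
    simp only [distinctValues, Finset.mem_image, Finset.mem_univ, true_and] at hv
    let S : Finset (Fin n) := Finset.univ.filter (fun k => x k = v)
    have hS : S.Nonempty := by
      obtain ⟨k, hk⟩ := hv
      exact ⟨k, by simp [S, hk]⟩
    have hm : x (S.min' hS) = v := by
      have := S.min'_mem hS
      simpa [S] using this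
    refine ⟨S.min' hS, ?_, hm⟩
    simp only [Finset.mem_filter, Finset.mem_univ, true_and]
    intro j hj h
    have : j ∈ S := by simp [S, h, hm]
    exact absurd (S.min'_le j this) (not_le.mpr hj)
  · intro k _
    rfl

lemma sum_sampleFreq {n : ℕ} (x : Fin n → 𝕏) :
    ∑ v ∈ distinctValues x, sampleFreq x v = n := by
  classical
  have h := Finset.card_eq_sum_card_image x (Finset.univ : Finset (Fin n))
  rw [Finset.card_univ, Fintype.card_fin] at h
  conv_rhs => rw [h]
  unfold distinctValues
  refine Finset.sum_congr (by congr) fun v _ => ?_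
  simp [sampleFreq, Fintype.card_subtype]

variable [MeasurableSpace 𝕏]

/-- The Ewens–Pitman predictive distribution given the observations `x`:
`(θ + j α) / (θ + n) ν + 1 / (θ + n) ∑ (n_v - α) δ_v`, where the sum is over the `j` distinct
values `v` of the sample and `n_v` is the frequency of `v`. -/
noncomputable def predictiveMeasure (α θ : ℝ) (ν : Measure 𝕏) {n : ℕ} (x : Fin n → 𝕏) :
    Measure 𝕏 :=
  ENNReal.ofReal ((θ + ((distinctValues x).card : ℝ) * α) / (θ + n)) • ν
    + ∑ v ∈ distinctValues x,
        ENNReal.ofReal (((sampleFreq x v : ℝ) - α) / (θ + n)) • Measure.dirac v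

lemma measurable_predictiveMeasure [MeasurableEq 𝕏] (α θ : ℝ) (ν : Measure 𝕏) (n : ℕ) :
    Measurable (fun x : Fin n → 𝕏 => predictiveMeasure α θ ν x) := by
  classical
  have hmem : ∀ i j : Fin n, MeasurableSet {x : Fin n → 𝕏 | x i = x j} := fun i j =>
    measurableSet_eq_fun (measurable_pi_apply i) (measurable_pi_apply j)
  have hfirst : ∀ k : Fin n, MeasurableSet {x : Fin n → 𝕏 | ∀ j, j < k → x j ≠ x k} := by
    intro k
    simp only [Set.ofPred_forall]
    exact MeasurableSet.iInter fun j => MeasurableSet.iInter fun _ => (hmem j k).compl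
  have hfreq : ∀ k : Fin n, Measurable (fun x : Fin n → 𝕏 => sampleFreq x (x k)) := by
    intro k
    simp only [sampleFreq_eq_sum]
    exact Finset.measurable_sum _ fun j _ =>
      Measurable.ite (hmem j k) measurable_const measurable_const
  have hcard : Measurable (fun x : Fin n → 𝕏 => (distinctValues x).card) := by
    simp only [Finset.card_eq_sum_ones, sum_distinctValues]
    exact Finset.measurable_sum _ fun k _ =>
      Measurable.ite (hfirst k) measurable_const measurable_const
  refine Measure.measurable_of_measurable_coe _ fun B hB => ?_
  simp only [predictiveMeasure, Measure.coe_add, Pi.add_apply, Measure.coe_finsetSum,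
    Finset.sum_apply, Measure.smul_apply, smul_eq_mul]
  simp only [sum_distinctValues _ (fun v => ENNReal.ofReal _ * Measure.dirac v B)]
  refine Measurable.add (Measurable.mul_const ?_ _) (Finset.measurable_sum _ fun k _ =>
    Measurable.ite (hfirst k) (Measurable.mul ?_ ?_) measurable_const)
  · have : Measurable (fun x : Fin n → 𝕏 => ((distinctValues x).card : ℝ)) :=
      measurable_from_top.comp hcard
    exact (((this.mul_const α).const_add θ).div_const _).ennreal_ofReal
  · have : Measurable (fun x : Fin n → 𝕏 => (sampleFreq x (x k) : ℝ)) :=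
      measurable_from_top.comp (hfreq k)
    exact ((this.sub_const α).div_const _).ennreal_ofReal
  · exact (Measure.measurable_coe hB).comp (Measure.measurable_dirac.comp (measurable_pi_apply k))

/-- The predictive distributions given `n` observations, as a kernel. -/
noncomputable def predictiveKernel [MeasurableEq 𝕏] (α θ : ℝ) (ν : Measure 𝕏) (n : ℕ) :
    Kernel (Fin n → 𝕏) 𝕏 where
  toFun x := predictiveMeasure α θ ν x
  measurable' := measurable_predictiveMeasure α θ ν n

/-- The predictive distributions are probability measures. -/
lemma isMarkovKernel_predictiveKernel [MeasurableEq 𝕏] {α θ : ℝ} (hα : α ∈ Ioo (0 : ℝ) 1)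
    (hθ : -α < θ) (ν : Measure 𝕏) [IsProbabilityMeasure ν] {n : ℕ} (hn : 1 ≤ n) :
    IsMarkovKernel (predictiveKernel α θ ν n) := by
  classical
  refine ⟨fun x => ⟨?_⟩⟩
  have hn' : (1 : ℝ) ≤ n := by exact_mod_cast hn
  have hpos : 0 < θ + n := by linarith [hα.2]
  have hfr : ∀ v ∈ distinctValues x, (1 : ℝ) ≤ sampleFreq x v := by
    intro v hv
    simp only [distinctValues, Finset.mem_image, Finset.mem_univ, true_and] at hv
    obtain ⟨k, hk⟩ := hv
    have : 0 < sampleFreq x v := by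
      have : Nonempty {k : Fin n // x k = v} := ⟨⟨k, hk⟩⟩
      exact Nat.card_pos
    exact_mod_cast this
  have hcard : (1 : ℝ) ≤ (distinctValues x).card := by
    have : (distinctValues x).Nonempty :=
      ⟨x ⟨0, hn⟩, by simp [distinctValues]⟩
    exact_mod_cast this.card_pos
  have hsum : ∑ v ∈ distinctValues x, (sampleFreq x v : ℝ) = n := by
    exact_mod_cast sum_sampleFreq x
  change predictiveMeasure α θ ν x univ = 1
  simp only [predictiveMeasure, Measure.coe_add, Pi.add_apply, Measure.coe_finsetSum,
    Finset.sum_apply, Measure.smul_apply, smul_eq_mul, measure_univ, mul_one]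
  rw [← ENNReal.ofReal_sum_of_nonneg, ← ENNReal.ofReal_add, ← Finset.sum_div,
    Finset.sum_sub_distrib, hsum, ← add_div]
  · rw [Finset.sum_const, nsmul_eq_mul,
      show θ + ((distinctValues x).card : ℝ) * α + (n - ((distinctValues x).card : ℝ) * α)
        = θ + n by ring, div_self hpos.ne', ENNReal.ofReal_one]
  · exact div_nonneg (by nlinarith [hα.1]) hpos.le
  · exact Finset.sum_nonneg fun v hv =>
      div_nonneg (by linarith [hfr v hv, hα.2]) hpos.le
  · exact fun v hv => div_nonneg (by linarith [hfr v hv, hα.2]) hpos.le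

/-- `X 0, X 1, …` is a sequence of observations generated by the Ewens–Pitman sampling model
with parameters `α`, `θ` and base measure `ν`: the first observation has law `ν`, and for
`n ≥ 1` the conditional distribution of `X n` given `(X 0, …, X (n - 1))` is the predictive
distribution. -/
structure IsEwensPitmanSequence [MeasurableEq 𝕏] {Ω : Type*} [MeasurableSpace Ω]
    (α θ : ℝ) (ν : Measure 𝕏) (P : Measure Ω) (X : ℕ → Ω → 𝕏) : Prop where
  measurable : ∀ n, Measurable (X n)
  hasLaw_zero : HasLaw (X 0) ν P
  hasCondDistrib : ∀ n, 1 ≤ n →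
    HasCondDistrib (X n) (fun ω (i : Fin n) => X i ω) (predictiveKernel α θ ν n) P

end EwensPitman

/-- `M_{l,n}`: the number of blocks with frequency `l` in the partition induced by the first
`n` observations. -/
noncomputable def numBlocks {𝕏 Ω : Type*} (X : ℕ → Ω → 𝕏) (l n : ℕ) (ω : Ω) : ℕ :=
  blockCount l (fun i : Fin n => X i ω)

/-!
## The rate function
-/

/-- `h₁(λ) = λ + log ((e^λ - 1) / e^λ) + log (α (1 - α)_{(l-1)} / (α^α l!))`, where
`(x)_{(m)} = x (x + 1) ⋯ (x + m - 1)`. -/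
noncomputable def ewensH₁ (α : ℝ) (l : ℕ) (t : ℝ) : ℝ :=
  t + Real.log ((Real.exp t - 1) / Real.exp t)
    + Real.log (α * (ascPochhammer ℝ (l - 1)).eval (1 - α) / (α ^ α * (l.factorial : ℝ)))

/-- `h₂(ε) = l log ((1 - (l - α) ε) / (1 - l ε)) + α log (ε / (1 - (l - α) ε))`, for
`0 < ε < 1 / l`. -/
noncomputable def ewensH₂ (α : ℝ) (l : ℕ) (ε : ℝ) : ℝ :=
  l * Real.log ((1 - (l - α) * ε) / (1 - l * ε)) + α * Real.log (ε / (1 - (l - α) * ε))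

/-- `ε₀(λ) = h₂⁻¹ (h₁ λ)`, with the inverse of `h₂` on `(0, 1 / l)`. -/
noncomputable def epsZero (α : ℝ) (l : ℕ) (t : ℝ) : ℝ :=
  Function.invFunOn (ewensH₂ α l) (Ioo (0 : ℝ) (1 / l)) (ewensH₁ α l t)

/-- `Λ_{α,l}(λ) = log (1 + α ε₀(λ) / (1 - l ε₀(λ)))` for `λ > 0`, and `0` for `λ ≤ 0`. -/
noncomputable def limitCgf (α : ℝ) (l : ℕ) (t : ℝ) : ℝ :=
  if 0 < t then Real.log (1 + α * epsZero α l t / (1 - l * epsZero α l t)) else 0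

/-- `I_l^α(x) = sup_λ {λ x - Λ_{α,l}(λ)}`, with values in the extended reals. -/
noncomputable def rateFunction (α : ℝ) (l : ℕ) (x : ℝ) : EReal :=
  ⨆ t : ℝ, ((t * x - limitCgf α l t : ℝ) : EReal)

/-!
The argument rests on a renewal structure hidden in the model.

Put `p_k = α (1 - α)_{(k-1)} / k!`, so that `∑ p_k x ^ k = 1 - (1 - x) ^ α`. Give a composition
`k₁ + ⋯ + k_r = n` the weight `∏ p_{kᵢ}`. These weights are compatible with the growth dynamics
which inserts a new part `1` at any of the `r + 1` positions with rate `α` and enlarges a part `k`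
with rate `k - α` (`compSum_insertOp`). For `θ = α` this is exactly the dynamics of the block sizes
of the Ewens–Pitman sample; for other `θ` the law of the block sizes is obtained by inserting a
factor which depends on the number of blocks only, and subexponentially so
(`IsEwensPitmanSequence.totalWeight_mul_integral`). Hence `θ` does not influence exponential rates,
and `E[e^{t M_{l,n}}]` grows like the sequence `u_n` of total weights with an extra factor `e^t` for
each part `l`. Splitting off the first part gives `u_n = ∑ b_k u_{n-k}`, where `b_k = p_k` except
that `b_l = e^t p_l`, and such a sequence grows like `x⁻ⁿ`, where `x` solves `∑ b_k x ^ k = 1`,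
that is `(1 - x) ^ α = (e^t - 1) p_l x ^ l` (`tendsto_log_renewal`). For `t > 0` the substitution
`x = (1 - l ε) / (1 - (l - α) ε)` turns this equation into `h₂ ε = h₁ t`, and `-log x` into
`Λ_{α,l}(t)` (`limitCgf_equation`). For `t ≤ 0` the rate is zero, since a single block of size `n`
has only polynomially small probability (`IsEwensPitmanSequence.tendsto_cgf_numBlocks`).

The large deviation principle is a one-dimensional Gärtner–Ellis argument for the variables
`M_{l,n} ∈ [0, n / l]`. The function `Λ_{α,l}` is differentiable: on `(0, ∞)` it is the inverse of
an explicit function, and at `0` it is of order `t ^ (1 / α)` with `1 / α > 1`, so that both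
one-sided derivatives vanish. Upper bounds are Chernoff bounds (`limsup_upper_tail_le`); lower
bounds come from exponential tilting at a point `t` where the slope of `Λ_{α,l}` is `x`
(`le_liminf_ball`), and every `x ∈ (0, 1 / l)` is such a slope because
`t / l - C ≤ Λ_{α,l}(t) ≤ t / l` for `t ≥ 0`. The rate function is monotone on `[0, ∞)`, which yields the tail asymptotics at
all but countably many points.
-/

/-! ### Weighted sums over compositions -/

/-- The weights `α (1 - α)_{(k-1)} / k!` of the blocks of size `k ≥ 1`; they are the coefficients
of the power series `1 - (1 - x) ^ α`. The value at `k = 0` plays no role. -/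
noncomputable def stableWeight (α : ℝ) (k : ℕ) : ℝ :=
  α * (ascPochhammer ℝ (k - 1)).eval (1 - α) / (k.factorial : ℝ)

/-- The sum of `(∏ i, p kᵢ) * F [k₁, …, k_r]` over all compositions `k₁ + ⋯ + k_r = n` of `n` into
positive parts, organised as a recursion on the first part. -/
noncomputable def compSum (p : ℕ → ℝ) : ℕ → (List ℕ → ℝ) → ℝ
  | 0, F => F []
  | n + 1, F => ∑ k ∈ Finset.range (n + 1),
      p (k + 1) * compSum p (n - k) (fun L => F ((k + 1) :: L))
termination_by n => n
decreasing_by omega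

/-- The generator of the growth dynamics on compositions: a new part `1` is inserted at each of the
possible positions with rate `α`, and a part `k` is increased by one with rate `k - α`. -/
def insertOp (α : ℝ) : (List ℕ → ℝ) → List ℕ → ℝ
  | F, [] => α * F [1]
  | F, k :: L => α * F (1 :: k :: L) + (k - α) * F ((k + 1) :: L)
      + insertOp α (fun L' => F (k :: L')) L

lemma stableWeight_pos {α : ℝ} (hα : α ∈ Ioo (0 : ℝ) 1) (k : ℕ) : 0 < stableWeight α k := by
  have := ascPochhammer_pos (k - 1) (1 - α) (by linarith [hα.2])
  exact div_pos (mul_pos hα.1 this) (by positivity)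

lemma stableWeight_one (α : ℝ) : stableWeight α 1 = α := by simp [stableWeight]

lemma stableWeight_succ (α : ℝ) {k : ℕ} (hk : 1 ≤ k) :
    (k + 1 : ℝ) * stableWeight α (k + 1) = (k - α) * stableWeight α k := by
  obtain ⟨m, rfl⟩ : ∃ m, k = m + 1 := ⟨k - 1, by omega⟩
  simp only [stableWeight, Nat.add_sub_cancel, ascPochhammer_succ_eval]
  rw [Nat.factorial_succ (m + 1)]
  push_cast
  field_simp
  ring

section compSum

variable (p : ℕ → ℝ)

lemma compSum_zero (F : List ℕ → ℝ) : compSum p 0 F = F [] := by rw [compSum]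

lemma compSum_succ (n : ℕ) (F : List ℕ → ℝ) :
    compSum p (n + 1) F = ∑ k ∈ Finset.range (n + 1),
      p (k + 1) * compSum p (n - k) (fun L => F ((k + 1) :: L)) := by rw [compSum]

lemma compSum_add (n : ℕ) (F G : List ℕ → ℝ) :
    compSum p n (fun L => F L + G L) = compSum p n F + compSum p n G := by
  induction n using Nat.strong_induction_on generalizing F G with
  | _ n ih =>
    cases n with
    | zero => simp [compSum_zero]
    | succ n =>
      simp only [compSum_succ, ← Finset.sum_add_distrib]
      refine Finset.sum_congr rfl fun k _ => ?_
      rw [ih (n - k) (by omega), mul_add]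

lemma compSum_const_mul (n : ℕ) (c : ℝ) (F : List ℕ → ℝ) :
    compSum p n (fun L => c * F L) = c * compSum p n F := by
  induction n using Nat.strong_induction_on generalizing F with
  | _ n ih =>
    cases n with
    | zero => simp [compSum_zero]
    | succ n =>
      simp only [compSum_succ, Finset.mul_sum]
      refine Finset.sum_congr rfl fun k _ => ?_
      rw [ih (n - k) (by omega)]
      ring

lemma compSum_congr (n : ℕ) {F G : List ℕ → ℝ}
    (h : ∀ L : List ℕ, L.sum = n → F L = G L) : compSum p n F = compSum p n G := by
  induction n using Nat.strong_induction_on generalizing F G with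
  | _ n ih =>
    cases n with
    | zero => simp only [compSum_zero]; exact h _ rfl
    | succ n =>
      simp only [compSum_succ]
      refine Finset.sum_congr rfl fun k hk => ?_
      have := Finset.mem_range.1 hk
      rw [ih (n - k) (by omega) fun L hL => h _ (by simp; omega)]

lemma compSum_mono {p : ℕ → ℝ} (hp : ∀ k, 0 ≤ p k) (n : ℕ) {F G : List ℕ → ℝ}
    (h : ∀ L : List ℕ, L.sum = n → L.length ≤ n → F L ≤ G L) :
    compSum p n F ≤ compSum p n G := by
  induction n using Nat.strong_induction_on generalizing F G with
  | _ n ih =>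
    cases n with
    | zero => simp only [compSum_zero]; exact h _ rfl le_rfl
    | succ n =>
      simp only [compSum_succ]
      refine Finset.sum_le_sum fun k hk => mul_le_mul_of_nonneg_left ?_ (hp _)
      have := Finset.mem_range.1 hk
      exact ih (n - k) (by omega) fun L hL hL' => h _ (by simp; omega) (by simp; omega)

/-- Growing a random composition by one unit: the predecessors of a composition of `n + 1` are
obtained by lowering one of its parts, and lowering the part `k` contributes the fraction
`k / (n + 1)` because `(k + 1) p (k + 1) = (k - α) p k` and `p 1 = α`. -/
lemma compSum_insertOp {α : ℝ} (h1 : p 1 = α)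
    (hp : ∀ k : ℕ, 1 ≤ k → (k + 1 : ℝ) * p (k + 1) = (k - α) * p k) (n : ℕ) (F : List ℕ → ℝ) :
    compSum p n (insertOp α F) = (n + 1) * compSum p (n + 1) F := by
  induction n using Nat.strong_induction_on generalizing F with
  | _ n ih =>
    cases n with
    | zero => simp [compSum_zero, compSum_succ, insertOp, h1]
    | succ n =>
      have e1 : compSum p (n + 1) (insertOp α F)
          = p 1 * compSum p (n + 1) (fun L => F (1 :: L))
            + ∑ k ∈ Finset.range (n + 1),
              (((k + 1 : ℕ) + 1 : ℝ) * p (k + 1 + 1)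
                  * compSum p (n - k) (fun L => F ((k + 1 + 1) :: L))
                + ((n - k : ℕ) + 1) * (p (k + 1)
                  * compSum p (n - k + 1) (fun L => F ((k + 1) :: L)))) := by
        rw [compSum_succ, compSum_succ p n (fun L => F (1 :: L)), Finset.mul_sum,
          ← Finset.sum_add_distrib]
        refine Finset.sum_congr rfl fun k hk => ?_
        simp only [insertOp]
        rw [compSum_add, compSum_add, compSum_const_mul, compSum_const_mul, ih _ (by omega),
          hp (k + 1) (by omega), h1]
        push_cast
        ring
      rw [e1, Finset.sum_add_distrib, ← add_assoc, compSum_succ p (n + 1), Finset.mul_sum]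
      have e2 : p 1 * compSum p (n + 1) (fun L => F (1 :: L))
            + ∑ k ∈ Finset.range (n + 1), ((k + 1 : ℕ) + 1 : ℝ) * p (k + 1 + 1)
                  * compSum p (n - k) (fun L => F ((k + 1 + 1) :: L))
          = ∑ k ∈ Finset.range (n + 2), (k + 1 : ℝ) * (p (k + 1)
              * compSum p (n + 1 - k) (fun L => F ((k + 1) :: L))) := by
        rw [Finset.sum_range_succ' _ (n + 1), add_comm]
        congr 1
        · refine Finset.sum_congr rfl fun k _ => ?_
          rw [Nat.add_sub_add_right]
          push_cast
          ring
        · simp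
      have e3 : ∑ k ∈ Finset.range (n + 1), (((n - k : ℕ) + 1 : ℝ) * (p (k + 1)
                  * compSum p (n - k + 1) (fun L => F ((k + 1) :: L))))
          = ∑ k ∈ Finset.range (n + 2), ((n : ℝ) + 1 - k) * (p (k + 1)
              * compSum p (n + 1 - k) (fun L => F ((k + 1) :: L))) := by
        rw [Finset.sum_range_succ _ (n + 1)]
        push_cast
        rw [sub_self, zero_mul, add_zero]
        refine Finset.sum_congr rfl fun k hk => ?_
        have hk' := Finset.mem_range.1 hk
        rw [show n + 1 - k = n - k + 1 by omega, Nat.cast_sub (by omega)]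
        ring
      rw [e2, e3, ← Finset.sum_add_distrib]
      refine Finset.sum_congr rfl fun k _ => ?_
      push_cast
      ring

/-- On functions of the multiset of parts, all insertion positions of the new part are equivalent. -/
lemma insertOp_coe (α : ℝ) (f : Multiset ℕ → ℝ) (L : List ℕ) :
    insertOp α (fun L' => f ↑L') L
      = (L.length + 1) * α * f (1 ::ₘ ↑L)
        + ((L : Multiset ℕ).map fun k => (k - α) * f ((k + 1) ::ₘ (L : Multiset ℕ).erase k)).sum
        := by
  induction L generalizing f with
  | nil => simp [insertOp]
  | cons k L ih =>
    have := ih (fun S => f (k ::ₘ S))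
    simp only [insertOp, ← Multiset.cons_coe] at this ⊢
    rw [this]
    simp only [Multiset.map_cons, Multiset.sum_cons, Multiset.erase_cons_head, List.length_cons]
    rw [Multiset.cons_swap k 1]
    have : (L : Multiset ℕ).map (fun j : ℕ =>
          ((j : ℝ) - α) * f ((j + 1) ::ₘ (k ::ₘ ↑L : Multiset ℕ).erase j))
        = (L : Multiset ℕ).map (fun j : ℕ =>
          ((j : ℝ) - α) * f (k ::ₘ (j + 1) ::ₘ (↑L : Multiset ℕ).erase j)) := by
      refine Multiset.map_congr rfl fun j hj => ?_
      rw [Multiset.erase_cons_tail_of_mem hj, Multiset.cons_swap]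
    rw [this]
    push_cast
    ring

end compSum

/-! ### Exponential growth of renewal-type sequences -/

/-- A solution of the renewal equation grows at most like `R ^ n`, where `R⁻¹` is the point at
which the generating function of `b` equals one; `b k` is the coefficient of the lag `k + 1`. -/
lemma renewal_le {b u : ℕ → ℝ} {R : ℝ} (hb : ∀ k, 0 ≤ b k) (hR : 0 < R) (h0 : u 0 = 1)
    (hu : ∀ n, u (n + 1) = ∑ k ∈ Finset.range (n + 1), b k * u (n - k))
    (hs : HasSum (fun k => b k * R⁻¹ ^ (k + 1)) 1) (n : ℕ) : u n ≤ R ^ n := by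
  induction n using Nat.strong_induction_on with
  | _ n ih =>
    cases n with
    | zero => simp [h0]
    | succ n =>
      calc u (n + 1) = ∑ k ∈ Finset.range (n + 1), b k * u (n - k) := hu n
        _ ≤ ∑ k ∈ Finset.range (n + 1), R ^ (n + 1) * (b k * R⁻¹ ^ (k + 1)) := by
            refine Finset.sum_le_sum fun k hk => ?_
            have hk' := Finset.mem_range.1 hk
            refine (mul_le_mul_of_nonneg_left (ih (n - k) (by omega)) (hb k)).trans (le_of_eq ?_)
            rw [show n + 1 = (n - k) + (k + 1) by omega, pow_add, inv_pow]
            field_simp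
        _ = R ^ (n + 1) * ∑ k ∈ Finset.range (n + 1), b k * R⁻¹ ^ (k + 1) := by
            rw [Finset.mul_sum]
        _ ≤ R ^ (n + 1) * 1 := by
            gcongr
            exact sum_le_hasSum _ (fun k _ => mul_nonneg (hb k) (by positivity)) hs
        _ = R ^ (n + 1) := mul_one _

/-- The lower bound matching `renewal_le`: for `r < R`, finitely many terms of the series have sum
at least one at `r⁻¹`, and the recursion restricted to these terms propagates `c * r ^ n ≤ u n`. -/
lemma le_renewal {b u : ℕ → ℝ} {R r : ℝ} (hb : ∀ k, 0 < b k) (hr : 0 < r) (hrR : r < R)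
    (hupos : ∀ n, 0 < u n)
    (hu : ∀ n, u (n + 1) = ∑ k ∈ Finset.range (n + 1), b k * u (n - k))
    (hs : HasSum (fun k => b k * R⁻¹ ^ (k + 1)) 1) : ∃ c > 0, ∀ n, c * r ^ n ≤ u n := by
  have hR : 0 < R := hr.trans hrR
  obtain ⟨N, hN⟩ : ∃ N : ℕ, 1 ≤ ∑ k ∈ Finset.range N, b k * r⁻¹ ^ (k + 1) := by
    have hlim := (hs.tendsto_sum_nat).const_mul (R / r)
    have h1 : 1 < R / r * 1 := by rw [mul_one, one_lt_div hr]; exact hrR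
    obtain ⟨N, hN⟩ := (hlim.eventually (lt_mem_nhds h1)).exists
    refine ⟨N, hN.le.trans ?_⟩
    rw [Finset.mul_sum]
    refine Finset.sum_le_sum fun k _ => ?_
    have : r⁻¹ = R / r * R⁻¹ := by field_simp
    rw [this, mul_pow]
    have h2 : R / r ≤ (R / r) ^ (k + 1) := by
      conv_lhs => rw [← pow_one (R / r)]
      exact pow_le_pow_right₀ (by linarith) (by omega)
    have h3 : 0 ≤ b k * R⁻¹ ^ (k + 1) := mul_nonneg (hb k).le (by positivity)
    calc R / r * (b k * R⁻¹ ^ (k + 1)) ≤ (R / r) ^ (k + 1) * (b k * R⁻¹ ^ (k + 1)) := by gcongr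
      _ = _ := by ring
  have hne : (Finset.range (N + 1)).Nonempty := ⟨0, by simp⟩
  let c := (Finset.range (N + 1)).inf' hne fun n => u n / r ^ n
  have hc : 0 < c := by
    rw [Finset.lt_inf'_iff]
    exact fun n _ => div_pos (hupos n) (by positivity)
  refine ⟨c, hc, fun n => ?_⟩
  induction n using Nat.strong_induction_on with
  | _ n ih =>
    rcases Nat.lt_or_ge n (N + 1) with h | h
    · have := Finset.inf'_le (fun n => u n / r ^ n) (Finset.mem_range.2 h)
      rwa [le_div_iff₀ (by positivity)] at this
    · obtain ⟨m, rfl⟩ : ∃ m, n = m + 1 := ⟨n - 1, by omega⟩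
      rw [hu m]
      calc c * r ^ (m + 1) ≤ c * r ^ (m + 1) * ∑ k ∈ Finset.range N, b k * r⁻¹ ^ (k + 1) :=
            le_mul_of_one_le_right (by positivity) hN
        _ = ∑ k ∈ Finset.range N, b k * (c * r ^ (m - k)) := by
            rw [Finset.mul_sum]
            refine Finset.sum_congr rfl fun k hk => ?_
            have hk' := Finset.mem_range.1 hk
            rw [show m + 1 = (m - k) + (k + 1) by omega, pow_add, inv_pow]
            field_simp
        _ ≤ ∑ k ∈ Finset.range N, b k * u (m - k) := by
            refine Finset.sum_le_sum fun k hk => mul_le_mul_of_nonneg_left ?_ (hb k).le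
            have hk' := Finset.mem_range.1 hk
            exact ih _ (by omega)
        _ ≤ ∑ k ∈ Finset.range (m + 1), b k * u (m - k) := by
            refine Finset.sum_le_sum_of_subset_of_nonneg
              (Finset.range_subset_range.2 (by omega)) fun k _ _ => ?_
            exact mul_nonneg (hb k).le (hupos _).le

lemma tendsto_log_renewal {b u : ℕ → ℝ} {y : ℝ} (hb : ∀ k, 0 < b k) (h0 : u 0 = 1)
    (hupos : ∀ n, 0 < u n)
    (hu : ∀ n, u (n + 1) = ∑ k ∈ Finset.range (n + 1), b k * u (n - k))
    (hs : HasSum (fun k => b k * Real.exp (-y) ^ (k + 1)) 1) :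
    Tendsto (fun n : ℕ => Real.log (u n) / n) atTop (𝓝 y) := by
  have hs' : HasSum (fun k => b k * (Real.exp y)⁻¹ ^ (k + 1)) 1 := by rwa [← Real.exp_neg]
  have hle := renewal_le (fun k => (hb k).le) (Real.exp_pos y) h0 hu hs'
  refine tendsto_order.2 ⟨fun a ha => ?_, fun a ha => ?_⟩
  · obtain ⟨a', haa', ha'⟩ := exists_between ha
    obtain ⟨c, hc, hcu⟩ := le_renewal hb (Real.exp_pos a') (Real.exp_lt_exp.2 ha') hupos hu hs'
    have hlim : Tendsto (fun n : ℕ => Real.log c / n) atTop (𝓝 0) :=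
      tendsto_const_nhds.div_atTop tendsto_natCast_atTop_atTop
    filter_upwards [hlim.eventually (lt_mem_nhds (show a - a' < 0 by linarith)),
      eventually_gt_atTop 0] with n hn hn0
    have hn0' : (0 : ℝ) < n := by exact_mod_cast hn0
    have := Real.log_le_log (by positivity) (hcu n)
    rw [Real.log_mul hc.ne' (by positivity), Real.log_pow, Real.log_exp] at this
    rw [lt_div_iff₀ hn0'] at hn ⊢
    linarith
  · filter_upwards [eventually_gt_atTop 0] with n hn0
    have hn0' : (0 : ℝ) < n := by exact_mod_cast hn0
    have := Real.log_le_log (hupos n) (hle n)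
    rw [Real.log_pow, Real.log_exp] at this
    rw [div_lt_iff₀ hn0']
    nlinarith

/-- A positive sequence whose successive ratios tend to one is subexponential. -/
lemma tendsto_log_div_of_ratio {a : ℕ → ℝ} (ha : ∀ n, 0 < a n)
    (h : Tendsto (fun n => a (n + 1) / a n) atTop (𝓝 1)) :
    Tendsto (fun n : ℕ => Real.log (a n) / n) atTop (𝓝 0) := by
  have h1 : Tendsto (fun n => Real.log (a (n + 1)) - Real.log (a n)) atTop (𝓝 0) := by
    have := (Real.continuousAt_log one_ne_zero).tendsto.comp h
    rw [Real.log_one] at this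
    refine this.congr fun n => ?_
    simp only [Function.comp]
    rw [Real.log_div (ha _).ne' (ha _).ne']
  have h2 := h1.cesaro
  have h3 : Tendsto (fun n : ℕ => Real.log (a 0) / n) atTop (𝓝 0) :=
    tendsto_const_nhds.div_atTop tendsto_natCast_atTop_atTop
  have := h2.add h3
  rw [add_zero] at this
  refine this.congr fun n => ?_
  rw [Finset.sum_range_sub (fun n => Real.log (a n))]
  ring

/-! ### The generating function of the block weights -/

lemma choose_mul_neg_one_pow (α : ℝ) (k : ℕ) :
    Ring.choose α (k + 1) * (-1) ^ (k + 1) = -stableWeight α (k + 1) := by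
  have hrec : ∀ m : ℕ, (m + 1 : ℝ) * Ring.choose α (m + 1) = (α - m) * Ring.choose α m := by
    intro m
    have h := Ring.choose_smul_choose α (Nat.le_succ m)
    rw [Nat.choose_succ_self_right, Nat.succ_sub (le_refl m), Nat.sub_self, Ring.choose_one_right,
      nsmul_eq_mul] at h
    push_cast at h
    rw [h, mul_comm]
  induction k with
  | zero => simp [stableWeight_one]
  | succ k ih =>
    have h1 := hrec (k + 1)
    have h2 := stableWeight_succ α (k := k + 1) (by omega)
    have h3 : ((k + 1 : ℕ) + 1 : ℝ) ≠ 0 := by positivity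
    refine mul_left_cancel₀ h3 ?_
    rw [← mul_assoc, h1, pow_succ, mul_neg (_ + 1), h2]
    linear_combination -(α - ((k + 1 : ℕ) : ℝ)) * ih

lemma hasSum_stableWeight (α : ℝ) {x : ℝ} (hx0 : 0 ≤ x) (hx : x < 1) :
    HasSum (fun k => stableWeight α (k + 1) * x ^ (k + 1)) (1 - (1 - x) ^ α) := by
  have h := (Real.one_add_rpow_hasFPowerSeriesOnBall_zero (a := α)).hasSum (y := -x) (by
    simp [enorm_eq_nnnorm, ← NNReal.coe_lt_coe, abs_of_nonneg hx0, hx])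
  have h' : HasSum (fun n => Ring.choose α n * (-x) ^ n) ((1 - x) ^ α) := by
    have e : (1 - x) ^ α = (1 + (0 + -x)) ^ α := by rw [zero_add, sub_eq_add_neg]
    rw [e]
    have e' : (fun n => Ring.choose α n * (-x) ^ n)
        = fun n => (binomialSeries ℝ α n) fun _ => -x := by
      ext n
      simp [binomialSeries_apply, -FormalMultilinearSeries.apply_eq_prod_smul_coeff]
    rwa [e']
  rw [← hasSum_nat_add_iff' 1] at h'
  have e : 1 - (1 - x) ^ α
      = -((1 - x) ^ α - ∑ i ∈ Finset.range 1, Ring.choose α i * (-x) ^ i) := by simp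
  have e' : (fun k => stableWeight α (k + 1) * x ^ (k + 1))
      = fun k => -(Ring.choose α (k + 1) * (-x) ^ (k + 1)) := by
    ext k
    rw [neg_pow x, ← mul_assoc, choose_mul_neg_one_pow]
    ring
  rw [e, e']
  exact h'.neg

/-- If `1 - ∑ p k x ^ k` with the weight `p l` multiplied by `s` vanishes at `x = exp (-y)`, then
the total weight of the compositions of `n` with a factor `s` for each part `l` grows
like `exp (n y)`. -/
lemma tendsto_log_compSum_count {α : ℝ} (hα : α ∈ Ioo (0 : ℝ) 1) {l : ℕ} (hl : 1 ≤ l) {s y : ℝ}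
    (hs : 0 < s) (hy : 0 < y)
    (h : (s - 1) * stableWeight α l * Real.exp (-y) ^ l = (1 - Real.exp (-y)) ^ α) :
    Tendsto (fun n : ℕ => Real.log (compSum (stableWeight α) n fun L => s ^ L.count l) / n) atTop
      (𝓝 y) := by
  have hp := stableWeight_pos hα
  have hu : ∀ n, compSum (stableWeight α) (n + 1) (fun L => s ^ L.count l)
      = ∑ k ∈ Finset.range (n + 1), (stableWeight α (k + 1) * if k + 1 = l then s else 1)
        * compSum (stableWeight α) (n - k) fun L => s ^ L.count l := by
    intro n
    rw [compSum_succ]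
    refine Finset.sum_congr rfl fun k _ => ?_
    rw [mul_assoc]
    congr 1
    rw [← compSum_const_mul]
    refine compSum_congr _ _ fun L _ => ?_
    by_cases hk : k + 1 = l
    · simp [hk, pow_succ, mul_comm]
    · simp [hk]
  have hb : ∀ k : ℕ, 0 < stableWeight α (k + 1) * if k + 1 = l then s else 1 := by
    intro k
    refine mul_pos (hp _) ?_
    split_ifs <;> linarith
  refine tendsto_log_renewal hb (by simp [compSum_zero]) ?_ hu ?_
  · intro n
    induction n using Nat.strong_induction_on with
    | _ n ih =>
      cases n with
      | zero => simp [compSum_zero]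
      | succ n =>
        rw [hu]
        exact Finset.sum_pos (fun k _ => mul_pos (hb k) (ih _ (by omega))) ⟨0, by simp⟩
  · have h1 := hasSum_stableWeight α (Real.exp_pos (-y)).le (by simpa using hy)
    have h2 : HasSum (fun k : ℕ => if k = l - 1 then
        (s - 1) * stableWeight α l * Real.exp (-y) ^ l else 0)
        ((s - 1) * stableWeight α l * Real.exp (-y) ^ l) := hasSum_ite_eq _ _
    convert h1.add h2 using 1
    · ext k
      by_cases hk : k + 1 = l
      · subst hk
        simp
        ring
      · rw [if_neg hk, if_neg (by omega)]
        ring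
    · rw [h]
      ring

/-! ### The block sizes of an Ewens–Pitman sample -/

section blockSizes

variable {𝕏 : Type*}

/-- The multiset of the block sizes of the partition induced by the sample `x`. -/
noncomputable def blockSizes {n : ℕ} (x : Fin n → 𝕏) : Multiset ℕ :=
  (distinctValues x).val.map (sampleFreq x)

lemma mem_distinctValues {n : ℕ} {x : Fin n → 𝕏} {v : 𝕏} :
    v ∈ distinctValues x ↔ ∃ k, x k = v := by
  simp [distinctValues]

lemma sampleFreq_pos {n : ℕ} {x : Fin n → 𝕏} {v : 𝕏} (hv : v ∈ distinctValues x) :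
    0 < sampleFreq x v := by
  obtain ⟨k, hk⟩ := mem_distinctValues.1 hv
  have : Nonempty {k : Fin n // x k = v} := ⟨⟨k, hk⟩⟩
  exact Nat.card_pos

lemma sampleFreq_eq_zero {n : ℕ} {x : Fin n → 𝕏} {v : 𝕏} (hv : v ∉ distinctValues x) :
    sampleFreq x v = 0 := by
  have : IsEmpty {k : Fin n // x k = v} := ⟨fun k => hv (mem_distinctValues.2 ⟨k.1, k.2⟩)⟩
  exact Nat.card_of_isEmpty

lemma blockCount_eq_count {n : ℕ} (l : ℕ) (x : Fin n → 𝕏) :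
    blockCount l x = (blockSizes x).count l := by
  rw [blockCount, blockSizes, Multiset.count_map, Finset.card_def, Finset.filter_val]
  simp only [eq_comm]

lemma card_blockSizes {n : ℕ} (x : Fin n → 𝕏) :
    (blockSizes x).card = (distinctValues x).card := by simp [blockSizes]

lemma sum_blockSizes {n : ℕ} (x : Fin n → 𝕏) : (blockSizes x).sum = n := by
  conv_rhs => rw [← sum_sampleFreq x]
  rfl

lemma mul_blockCount_le {n : ℕ} (l : ℕ) (x : Fin n → 𝕏) : l * blockCount l x ≤ n := by
  conv_rhs => rw [← sum_sampleFreq x]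
  rw [blockCount, mul_comm, ← smul_eq_mul, ← Finset.sum_const]
  calc _ = ∑ v ∈ (distinctValues x).filter (fun v => sampleFreq x v = l), sampleFreq x v :=
        Finset.sum_congr rfl fun v hv => ((Finset.mem_filter.1 hv).2).symm
    _ ≤ _ := Finset.sum_le_sum_of_subset (Finset.filter_subset _ _)

lemma finite_range_blockSizes (𝕏 : Type*) (n : ℕ) :
    (range (blockSizes : (Fin n → 𝕏) → Multiset ℕ)).Finite := by
  refine (finite_range (Nat.Partition.parts (n := n))).subset ?_
  rintro _ ⟨x, rfl⟩
  refine ⟨⟨blockSizes x, fun hi => ?_, sum_blockSizes x⟩, rfl⟩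
  obtain ⟨v, hv, rfl⟩ := Multiset.mem_map.1 hi
  exact sampleFreq_pos hv

lemma sampleFreq_snoc {n : ℕ} (x : Fin n → 𝕏) (y v : 𝕏) [DecidableEq 𝕏] :
    sampleFreq (Fin.snoc x y : Fin (n + 1) → 𝕏) v = sampleFreq x v + if y = v then 1 else 0 := by
  rw [sampleFreq_eq_sum, sampleFreq_eq_sum, Fin.sum_univ_castSucc]
  simp

lemma distinctValues_snoc {n : ℕ} (x : Fin n → 𝕏) (y : 𝕏) [DecidableEq 𝕏] :
    distinctValues (Fin.snoc x y : Fin (n + 1) → 𝕏) = insert y (distinctValues x) := by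
  ext v
  rw [mem_distinctValues, Finset.mem_insert, mem_distinctValues, Fin.exists_fin_succ']
  simp only [Fin.snoc_castSucc, Fin.snoc_last]
  tauto

lemma blockSizes_snoc_of_notMem {n : ℕ} {x : Fin n → 𝕏} {y : 𝕏} (hy : y ∉ distinctValues x) :
    blockSizes (Fin.snoc x y : Fin (n + 1) → 𝕏) = 1 ::ₘ blockSizes x := by
  classical
  rw [blockSizes, distinctValues_snoc, Finset.insert_val_of_notMem hy, Multiset.map_cons,
    sampleFreq_snoc, sampleFreq_eq_zero hy, if_pos rfl, zero_add, blockSizes]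
  congr 1
  refine Multiset.map_congr rfl fun v hv => ?_
  rw [sampleFreq_snoc, if_neg, add_zero]
  rintro rfl
  exact hy hv

lemma blockSizes_snoc_of_mem {n : ℕ} {x : Fin n → 𝕏} {y : 𝕏} (hy : y ∈ distinctValues x) :
    blockSizes (Fin.snoc x y : Fin (n + 1) → 𝕏)
      = (sampleFreq x y + 1) ::ₘ (blockSizes x).erase (sampleFreq x y) := by
  classical
  obtain ⟨S, hS⟩ := Multiset.exists_cons_of_mem (show y ∈ (distinctValues x).val from hy)
  have hyS : y ∉ S := by
    have := (distinctValues x).nodup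
    rw [hS] at this
    exact (Multiset.nodup_cons.1 this).1
  rw [blockSizes, distinctValues_snoc, Finset.insert_eq_self.2 hy, blockSizes, hS,
    Multiset.map_cons, Multiset.map_cons, Multiset.erase_cons_head, sampleFreq_snoc, if_pos rfl]
  congr 1
  refine Multiset.map_congr rfl fun v hv => ?_
  rw [sampleFreq_snoc, if_neg, add_zero]
  rintro rfl
  exact hyS hv

/-- The expected value of `f` at the next partition, times `θ + n`, given that the current block
sizes are `S`. -/
noncomputable def blockStep (α θ : ℝ) (f : Multiset ℕ → ℝ) (S : Multiset ℕ) : ℝ :=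
  (θ + S.card * α) * f (1 ::ₘ S) + (S.map fun k => (k - α) * f ((k + 1) ::ₘ S.erase k)).sum

variable [MeasurableSpace 𝕏]

lemma measurable_comp_blockSizes [MeasurableEq 𝕏] {n : ℕ} (f : Multiset ℕ → ℝ) :
    Measurable fun x : Fin n → 𝕏 => f (blockSizes x) := by
  classical
  let _ : MeasurableSpace (Multiset ℕ) := ⊤
  have hmem : ∀ i j : Fin n, MeasurableSet {x : Fin n → 𝕏 | x i = x j} := fun i j =>
    measurableSet_eq_fun (measurable_pi_apply i) (measurable_pi_apply j)
  have h : ∀ x : Fin n → 𝕏, blockSizes x = ∑ k, if (∀ j, j < k → x j ≠ x k) then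
      ({sampleFreq x (x k)} : Multiset ℕ) else 0 := by
    intro x
    rw [← sum_distinctValues x fun v => ({sampleFreq x v} : Multiset ℕ), blockSizes,
      Finset.sum_eq_multiset_sum, ← Multiset.bind_singleton]
    rfl
  have hfreq : ∀ k : Fin n, Measurable (fun x : Fin n → 𝕏 => sampleFreq x (x k)) := by
    intro k
    simp only [sampleFreq_eq_sum]
    exact Finset.measurable_sum _ fun j _ =>
      Measurable.ite (hmem j k) measurable_const measurable_const
  have : Measurable (blockSizes : (Fin n → 𝕏) → Multiset ℕ) := by
    rw [show (blockSizes : (Fin n → 𝕏) → Multiset ℕ) = _ from funext h]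
    refine Finset.measurable_sum _ fun k _ => Measurable.ite ?_ ?_ measurable_const
    · simp only [Set.ofPred_forall]
      exact MeasurableSet.iInter fun j => MeasurableSet.iInter fun _ => (hmem j k).compl
    · exact (measurable_from_top (f := fun m : ℕ => ({m} : Multiset ℕ))).comp (hfreq k)
  exact (measurable_from_top (f := f)).comp this

lemma integrable_comp_blockSizes [MeasurableEq 𝕏] {Ω : Type*} [MeasurableSpace Ω]
    (Q : Measure Ω) [IsFiniteMeasure Q] {n : ℕ} (f : Multiset ℕ → ℝ) {Y : Ω → Fin n → 𝕏}
    (hY : Measurable Y) : Integrable (fun ω => f (blockSizes (Y ω))) Q := by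
  obtain ⟨C, hC⟩ := ((finite_range_blockSizes 𝕏 n).image fun S => ‖f S‖).bddAbove
  refine Integrable.of_bound ((measurable_comp_blockSizes f).comp hY).aestronglyMeasurable C
    (ae_of_all _ fun ω => hC ⟨_, ⟨Y ω, rfl⟩, rfl⟩)

lemma integral_predictiveMeasure [MeasurableSingletonClass 𝕏] [MeasurableEq 𝕏] {α θ : ℝ}
    (hα : α ∈ Ioo (0 : ℝ) 1)
    (hθ : -α < θ) (ν : Measure 𝕏) [IsProbabilityMeasure ν] [NullSingletonClass ν] {n : ℕ}
    (hn : 1 ≤ n) (x : Fin n → 𝕏) (f : Multiset ℕ → ℝ) :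
    ∫ y, f (blockSizes (Fin.snoc x y : Fin (n + 1) → 𝕏)) ∂predictiveMeasure α θ ν x
      = blockStep α θ f (blockSizes x) / (θ + n) := by
  have hn' : (1 : ℝ) ≤ n := by exact_mod_cast hn
  have hpos : 0 < θ + n := by linarith [hα.2]
  have hcard : (1 : ℝ) ≤ (distinctValues x).card := by
    have : (distinctValues x).Nonempty := ⟨x ⟨0, hn⟩, by simp [distinctValues]⟩
    exact_mod_cast this.card_pos
  have hsnoc : Measurable fun y => (Fin.snoc x y : Fin (n + 1) → 𝕏) := by
    refine measurable_pi_lambda _ fun i => ?_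
    refine Fin.lastCases ?_ (fun i => ?_) i
    · simp only [Fin.snoc_last]
      exact measurable_id
    · simp only [Fin.snoc_castSucc]
      exact measurable_const
  have hint : ∀ (Q : Measure 𝕏) [IsFiniteMeasure Q],
      Integrable (fun y => f (blockSizes (Fin.snoc x y : Fin (n + 1) → 𝕏))) Q :=
    fun Q _ => integrable_comp_blockSizes Q f hsnoc
  have hnew : ∫ y, f (blockSizes (Fin.snoc x y : Fin (n + 1) → 𝕏)) ∂ν
      = f (1 ::ₘ blockSizes x) := by
    have hae : ∀ᵐ y ∂ν, y ∉ (distinctValues x : Set 𝕏) :=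
      measure_eq_zero_iff_ae_notMem.1 ((distinctValues x).finite_toSet.measure_zero ν)
    rw [integral_congr_ae (g := fun _ => f (1 ::ₘ blockSizes x))
      (hae.mono fun y hy => by simp only [blockSizes_snoc_of_notMem (by simpa using hy)])]
    simp
  rw [predictiveMeasure, integral_add_measure
      ((hint ν).smul_measure ENNReal.ofReal_ne_top)
      (integrable_finsetSum_measure.2 fun v _ => (hint _).smul_measure ENNReal.ofReal_ne_top),
    integral_finsetSum_measure fun v _ => (hint _).smul_measure ENNReal.ofReal_ne_top,
    integral_smul_measure, hnew, blockStep, card_blockSizes, ENNReal.toReal_ofReal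
      (div_nonneg (by nlinarith [hα.1]) hpos.le), add_div (_ * _)]
  congr 1
  · rw [smul_eq_mul]
    ring
  · rw [blockSizes, Multiset.map_map, ← blockSizes, ← Finset.sum_eq_multiset_sum, Finset.sum_div]
    refine Finset.sum_congr rfl fun v hv => ?_
    have h1 : (1 : ℝ) ≤ sampleFreq x v := by exact_mod_cast sampleFreq_pos hv
    rw [integral_smul_measure, integral_dirac, blockSizes_snoc_of_mem hv,
      ENNReal.toReal_ofReal (div_nonneg (by linarith [hα.2]) hpos.le), smul_eq_mul]
    simp only [Function.comp]
    ring

end blockSizes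

lemma IsEwensPitmanSequence.integral_blockSizes_succ {𝕏 : Type*} [MeasurableSpace 𝕏]
    [MeasurableSingletonClass 𝕏] [MeasurableEq 𝕏] {Ω : Type*} [MeasurableSpace Ω]
    {α θ : ℝ} {ν : Measure 𝕏} [IsProbabilityMeasure ν] [NullSingletonClass ν]
    {P : Measure Ω} [IsProbabilityMeasure P] {X : ℕ → Ω → 𝕏} (hα : α ∈ Ioo (0 : ℝ) 1)
    (hθ : -α < θ) (hX : IsEwensPitmanSequence α θ ν P X) {n : ℕ} (hn : 1 ≤ n)
    (f : Multiset ℕ → ℝ) :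
    ∫ ω, f (blockSizes fun i : Fin (n + 1) => X i ω) ∂P
      = (∫ ω, blockStep α θ f (blockSizes fun i : Fin n => X i ω) ∂P) / (θ + n) := by
  have := isMarkovKernel_predictiveKernel hα hθ ν hn
  have hXn : Measurable fun ω (i : Fin n) => X i ω :=
    measurable_pi_lambda _ fun i => hX.measurable i
  have hsnoc : Measurable fun z : (Fin n → 𝕏) × 𝕏 => (Fin.snoc z.1 z.2 : Fin (n + 1) → 𝕏) := by
    refine measurable_pi_lambda _ fun i => ?_
    refine Fin.lastCases ?_ (fun i => ?_) i
    · simp only [Fin.snoc_last]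
      exact measurable_snd
    · simp only [Fin.snoc_castSucc]
      exact (measurable_pi_apply i).comp measurable_fst
  have hlaw := (hX.hasCondDistrib n hn).map_eq
  have e : ∀ ω, (fun i : Fin (n + 1) => X i ω)
      = Fin.snoc (fun i : Fin n => X i ω) (X n ω) := by
    intro ω
    ext i
    refine Fin.lastCases ?_ (fun i => ?_) i <;> simp
  have : IsProbabilityMeasure (P.map fun ω (i : Fin n) => X i ω) :=
    Measure.isProbabilityMeasure_map hXn.aemeasurable
  calc ∫ ω, f (blockSizes fun i : Fin (n + 1) => X i ω) ∂P
      = ∫ ω, (fun z : (Fin n → 𝕏) × 𝕏 => f (blockSizes (Fin.snoc z.1 z.2 : Fin (n + 1) → 𝕏)))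
          ((fun i : Fin n => X i ω), X n ω) ∂P := by simp only [e]
    _ = ∫ z, f (blockSizes (Fin.snoc z.1 z.2 : Fin (n + 1) → 𝕏))
          ∂(P.map fun ω => ((fun i : Fin n => X i ω), X n ω)) :=
        (integral_map (hXn.prodMk (hX.measurable n)).aemeasurable
          ((measurable_comp_blockSizes f).comp hsnoc).aestronglyMeasurable).symm
    _ = ∫ x, ∫ y, f (blockSizes (Fin.snoc x y : Fin (n + 1) → 𝕏)) ∂(predictiveKernel α θ ν n x)
          ∂(P.map fun ω (i : Fin n) => X i ω) := by
        rw [hlaw, Measure.integral_compProd (integrable_comp_blockSizes _ f hsnoc)]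
    _ = ∫ x, blockStep α θ f (blockSizes x) / (θ + n) ∂(P.map fun ω (i : Fin n) => X i ω) :=
        integral_congr_ae (ae_of_all _ fun x => integral_predictiveMeasure hα hθ ν hn x f)
    _ = _ := by
        rw [integral_map hXn.aemeasurable
          ((measurable_comp_blockSizes _).div_const _).aestronglyMeasurable, integral_div]

/-! ### Reduction to weighted compositions -/

/-- The weight, relative to the case `θ = α`, of a partition into `r ≥ 1` blocks:
`(θ / α + 1) ⋯ (θ / α + r - 1) / (α r!)`. -/
noncomputable def blockNumberWeight (α θ : ℝ) : ℕ → ℝ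
  | 0 => 1 / α
  | 1 => 1 / α
  | r + 2 => blockNumberWeight α θ (r + 1) * ((θ / α + (r + 1)) / (r + 2))

/-- `(θ + 1) ⋯ (θ + n - 1) / n!`, the total weight of the partitions of `n ≥ 1`
for `blockNumberWeight`. -/
noncomputable def totalWeight (θ : ℝ) : ℕ → ℝ
  | 0 => 1
  | 1 => 1
  | n + 2 => totalWeight θ (n + 1) * ((θ + (n + 1)) / (n + 2))

lemma blockNumberWeight_pos {α θ : ℝ} (hα : 0 < α) (hθ : -α < θ) (r : ℕ) :
    0 < blockNumberWeight α θ r := by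
  have h : -1 < θ / α := by rw [lt_div_iff₀ hα]; linarith
  match r with
  | 0 => exact one_div_pos.2 hα
  | 1 => exact one_div_pos.2 hα
  | r + 2 =>
    have hr : (0 : ℝ) ≤ r := Nat.cast_nonneg r
    exact mul_pos (blockNumberWeight_pos hα hθ (r + 1)) (div_pos (by linarith) (by positivity))

lemma totalWeight_pos {θ : ℝ} (hθ : -1 < θ) (n : ℕ) : 0 < totalWeight θ n := by
  match n with
  | 0 => exact one_pos
  | 1 => exact one_pos
  | n + 2 =>
    have hr : (0 : ℝ) ≤ n := Nat.cast_nonneg n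
    exact mul_pos (totalWeight_pos hθ (n + 1)) (div_pos (by linarith) (by positivity))

lemma tendsto_add_div_add (a b : ℝ) : Tendsto (fun n : ℕ => (a + n) / (b + n)) atTop (𝓝 1) := by
  have h : Tendsto (fun n : ℕ => (a / n + 1) / (b / n + 1)) atTop (𝓝 ((0 + 1) / (0 + 1))) :=
    ((tendsto_const_nhds.div_atTop tendsto_natCast_atTop_atTop).add_const 1).div
      ((tendsto_const_nhds.div_atTop tendsto_natCast_atTop_atTop).add_const 1) (by norm_num)
  rw [zero_add, div_one] at h
  refine h.congr' ?_
  filter_upwards [eventually_gt_atTop 0] with n hn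
  have : (n : ℝ) ≠ 0 := by exact_mod_cast hn.ne'
  rw [div_add_one this, div_add_one this, div_div_div_cancel_right₀ this]

lemma tendsto_log_blockNumberWeight {α θ : ℝ} (hα : 0 < α) (hθ : -α < θ) :
    Tendsto (fun r : ℕ => Real.log (blockNumberWeight α θ r) / r) atTop (𝓝 0) := by
  refine tendsto_log_div_of_ratio (blockNumberWeight_pos hα hθ) ?_
  rw [← tendsto_add_atTop_iff_nat 1]
  refine (tendsto_add_div_add (θ / α + 1) 2).congr fun r => ?_
  rw [show r + 1 + 1 = r + 2 by rfl, blockNumberWeight,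
    mul_div_cancel_left₀ _ (blockNumberWeight_pos hα hθ _).ne']
  ring

lemma tendsto_log_totalWeight {θ : ℝ} (hθ : -1 < θ) :
    Tendsto (fun n : ℕ => Real.log (totalWeight θ n) / n) atTop (𝓝 0) := by
  refine tendsto_log_div_of_ratio (totalWeight_pos hθ) ?_
  rw [← tendsto_add_atTop_iff_nat 1]
  refine (tendsto_add_div_add (θ + 1) 2).congr fun r => ?_
  rw [show r + 1 + 1 = r + 2 by rfl, totalWeight,
    mul_div_cancel_left₀ _ (totalWeight_pos hθ _).ne']
  ring

lemma insertOp_blockNumberWeight {α : ℝ} (hα : 0 < α) (θ : ℝ) (f : Multiset ℕ → ℝ) {L : List ℕ}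
    (hL : L ≠ []) :
    insertOp α (fun L' => blockNumberWeight α θ L'.length * f ↑L') L
      = blockNumberWeight α θ L.length * blockStep α θ f ↑L := by
  have h := insertOp_coe α (fun S => blockNumberWeight α θ S.card * f S) L
  simp only [Multiset.coe_card] at h
  rw [h]
  obtain ⟨r, hr⟩ : ∃ r, L.length = r + 1 :=
    ⟨L.length - 1, by have := List.length_pos_of_ne_nil hL; omega⟩
  have hmap : ((L : Multiset ℕ).map fun k : ℕ => ((k : ℝ) - α) *
        (blockNumberWeight α θ ((k + 1) ::ₘ (L : Multiset ℕ).erase k).card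
          * f ((k + 1) ::ₘ (L : Multiset ℕ).erase k)))
      = (L : Multiset ℕ).map fun k : ℕ => blockNumberWeight α θ L.length *
        (((k : ℝ) - α) * f ((k + 1) ::ₘ (L : Multiset ℕ).erase k)) := by
    refine Multiset.map_congr rfl fun k hk => ?_
    have : ((k + 1) ::ₘ (L : Multiset ℕ).erase k).card = L.length := by
      rw [Multiset.card_cons, Multiset.card_erase_add_one hk, Multiset.coe_card]
    rw [this]
    ring
  rw [hmap, Multiset.sum_map_mul_left, blockStep, mul_add, Multiset.card_cons,
    Multiset.coe_card, hr]
  congr 1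
  rw [blockNumberWeight]
  have : (r + 2 : ℝ) ≠ 0 := by positivity
  push_cast
  field_simp
  ring

/-- **Sampling formula.** The block sizes of an Ewens–Pitman sample, listed in a uniformly random
order, form a composition of `n` whose law has, with respect to the product weights `stableWeight`,
a density depending on the number of parts only: `blockNumberWeight`, normalised by `totalWeight`. -/
theorem IsEwensPitmanSequence.totalWeight_mul_integral {𝕏 : Type*} [MeasurableSpace 𝕏]
    [MeasurableSingletonClass 𝕏] [MeasurableEq 𝕏] {Ω : Type*} [MeasurableSpace Ω]
    {α θ : ℝ} {ν : Measure 𝕏} [IsProbabilityMeasure ν] [NullSingletonClass ν]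
    {P : Measure Ω} [IsProbabilityMeasure P] {X : ℕ → Ω → 𝕏} (hα : α ∈ Ioo (0 : ℝ) 1)
    (hθ : -α < θ) (hX : IsEwensPitmanSequence α θ ν P X) (n : ℕ) (f : Multiset ℕ → ℝ) :
    totalWeight θ (n + 1) * ∫ ω, f (blockSizes fun i : Fin (n + 1) => X i ω) ∂P
      = compSum (stableWeight α) (n + 1) fun L => blockNumberWeight α θ L.length * f ↑L := by
  induction n generalizing f with
  | zero =>
    have h : ∀ ω, blockSizes (fun i : Fin 1 => X i ω) = {1} := by
      intro ω
      have h0 : (fun i : Fin 1 => X i ω) = Fin.snoc (Fin.elim0 : Fin 0 → 𝕏) (X 0 ω) := by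
        ext i
        obtain rfl : i = Fin.last 0 := Subsingleton.elim _ _
        rw [Fin.snoc_last]
        rfl
      have h1 : distinctValues (Fin.elim0 : Fin 0 → 𝕏) = ∅ := by simp [distinctValues]
      rw [h0, blockSizes_snoc_of_notMem (by simp [h1]), blockSizes, h1]
      rfl
    simp only [zero_add, h]
    simp [compSum_succ, compSum_zero, blockNumberWeight, totalWeight, stableWeight_one, hα.1.ne']
  | succ n ih =>
    rw [hX.integral_blockSizes_succ hα hθ (by omega) f]
    have hn : (0 : ℝ) ≤ n := Nat.cast_nonneg n
    have hpos : 0 < θ + ((n + 1 : ℕ) : ℝ) := by push_cast; linarith [hα.2]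
    have h1 := ih (blockStep α θ f)
    rw [← compSum_congr _ _ fun L hL => insertOp_blockNumberWeight hα.1 θ f
        (by rintro rfl; simp at hL),
      compSum_insertOp _ (stableWeight_one α) fun k hk => stableWeight_succ α hk] at h1
    rw [totalWeight]
    have h2 : ((n : ℝ) + 2) ≠ 0 := by positivity
    push_cast at h1 hpos ⊢
    field_simp
    linear_combination h1

/-! ### The limiting cumulant generating function -/

/-- `l y + α log (1 - e^{-y})`: the function `h₂`, up to the constant `α log α`, in the
coordinate `y = log ((1 - (l - α) ε) / (1 - l ε))`. -/
noncomputable def cgfEquation (α : ℝ) (l : ℕ) (y : ℝ) : ℝ :=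
  l * y + α * Real.log (1 - Real.exp (-y))

section cgfEquation

variable {α : ℝ} {l : ℕ}

lemma one_sub_exp_neg_pos {y : ℝ} (hy : 0 < y) : 0 < 1 - Real.exp (-y) := by
  have : Real.exp (-y) < 1 := by simpa using hy
  linarith

lemma exp_sub_one_pos {t : ℝ} (ht : 0 < t) : 0 < Real.exp t - 1 :=
  sub_pos.2 (Real.one_lt_exp_iff.2 ht)

lemma hasDerivAt_cgfEquation (α : ℝ) (l : ℕ) {y : ℝ} (hy : 0 < y) :
    HasDerivAt (cgfEquation α l)
      (l + α * (Real.exp (-y) / (1 - Real.exp (-y)))) y := by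
  have h1 : HasDerivAt (fun y : ℝ => 1 - Real.exp (-y)) (Real.exp (-y)) y := by
    have := ((hasDerivAt_neg y).exp).const_sub 1
    simpa using this
  have h2 := (h1.log (one_sub_exp_neg_pos hy).ne').const_mul α
  have h3 := ((hasDerivAt_id y).const_mul (l : ℝ)).add h2
  simpa [cgfEquation, Function.comp_def] using! h3

lemma strictMonoOn_cgfEquation (hα : 0 < α) : StrictMonoOn (cgfEquation α l) (Ioi 0) := by
  intro y hy z hz hyz
  have hy' : 0 < y := hy
  have h1 : Real.exp (-z) < Real.exp (-y) := Real.exp_lt_exp.2 (by linarith)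
  have h2 : Real.log (1 - Real.exp (-y)) < Real.log (1 - Real.exp (-z)) :=
    Real.log_lt_log (one_sub_exp_neg_pos hy) (by linarith)
  have h3 : (l : ℝ) * y ≤ l * z := by gcongr
  have h4 := mul_lt_mul_of_pos_left h2 hα
  simp only [cgfEquation]
  linarith

lemma surjOn_cgfEquation (hα : 0 < α) (hl : 1 ≤ l) : SurjOn (cgfEquation α l) (Ioi 0) univ := by
  have hcont : ContinuousOn (cgfEquation α l) (Ioi 0) := fun y hy =>
    (hasDerivAt_cgfEquation α l hy).continuousAt.continuousWithinAt
  have hl' : (0 : ℝ) < l := by exact_mod_cast hl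
  have hexp : Tendsto (fun y : ℝ => 1 - Real.exp (-y)) (𝓝[>] 0) (𝓝[>] 0) := by
    refine tendsto_nhdsWithin_iff.2 ⟨?_, ?_⟩
    · have : ContinuousAt (fun y : ℝ => 1 - Real.exp (-y)) 0 := by fun_prop
      have := this.tendsto.mono_left (nhdsWithin_le_nhds (s := Ioi 0))
      simpa using this
    · filter_upwards [self_mem_nhdsWithin] with y hy using one_sub_exp_neg_pos hy
  have hbot : Tendsto (cgfEquation α l) (𝓝[>] 0) atBot := by
    have h1 : Tendsto (fun y : ℝ => l * y) (𝓝[>] 0) (𝓝 (l * 0)) :=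
      (continuous_const.mul continuous_id).continuousAt.tendsto.mono_left nhdsWithin_le_nhds
    exact h1.add_atBot ((Real.tendsto_log_nhdsGT_zero.comp hexp).const_mul_atBot hα)
  have htop : Tendsto (cgfEquation α l) atTop atTop := by
    have h1 : Tendsto (fun y : ℝ => l * y) atTop atTop := tendsto_id.const_mul_atTop hl'
    have h2 : Tendsto (fun y : ℝ => α * Real.log (1 - Real.exp (-y))) atTop
        (𝓝 (α * Real.log (1 - 0))) := by
      refine Tendsto.const_mul _ (Tendsto.log ?_ (by norm_num))
      exact (Real.tendsto_exp_atBot.comp tendsto_neg_atTop_atBot).const_sub 1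
    exact h1.atTop_add h2
  intro c _
  obtain ⟨a, ha0, ha⟩ := ((eventually_mem_nhdsWithin).and (hbot.eventually_le_atBot c)).exists
  obtain ⟨b, hb0, hb⟩ := ((eventually_gt_atTop (0 : ℝ)).and (htop.eventually_ge_atTop c)).exists
  exact (isPreconnected_Ioi.intermediate_value ha0 hb0 hcont) ⟨ha, hb⟩

end cgfEquation

/-- The change of variables `y = log ((1 - (l - α) ε) / (1 - l ε))`. -/
noncomputable def epsToCgf (α : ℝ) (l : ℕ) (ε : ℝ) : ℝ :=
  Real.log (1 + α * ε / (1 - l * ε))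

section epsToCgf

variable {α : ℝ} {l : ℕ}

lemma one_sub_mul_pos (hl : 1 ≤ l) {ε : ℝ} (hε : ε ∈ Ioo (0 : ℝ) (1 / l)) : 0 < 1 - l * ε := by
  have hl' : (0 : ℝ) < l := by exact_mod_cast hl
  have := hε.2
  rw [lt_div_iff₀ hl'] at this
  linarith

lemma epsToCgf_pos (hα : 0 < α) (hl : 1 ≤ l) {ε : ℝ} (hε : ε ∈ Ioo (0 : ℝ) (1 / l)) :
    0 < epsToCgf α l ε := by
  have h1 := one_sub_mul_pos hl hε
  have : 0 < α * ε / (1 - l * ε) := div_pos (mul_pos hα hε.1) h1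
  exact Real.log_pos (by linarith)

lemma ewensH₂_eq (hα : 0 < α) (hl : 1 ≤ l) {ε : ℝ} (hε : ε ∈ Ioo (0 : ℝ) (1 / l)) :
    ewensH₂ α l ε = cgfEquation α l (epsToCgf α l ε) - α * Real.log α := by
  have h1 := one_sub_mul_pos hl hε
  have h0 := hε.1
  have h2 : 0 < α * ε := mul_pos hα h0
  have h3 : 0 < 1 - (l - α) * ε := by nlinarith
  have h4 : 1 + α * ε / (1 - l * ε) = (1 - (l - α) * ε) / (1 - l * ε) := by
    rw [eq_div_iff h1.ne', add_mul, div_mul_cancel₀ _ h1.ne']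
    ring
  have h5 : 1 - Real.exp (-epsToCgf α l ε) = α * (ε / (1 - (l - α) * ε)) := by
    rw [epsToCgf, h4, Real.exp_neg, Real.exp_log (by positivity)]
    field_simp
    ring
  rw [cgfEquation, h5, Real.log_mul hα.ne' (by positivity), epsToCgf, h4, ewensH₂]
  ring

lemma bijOn_epsToCgf (hα : 0 < α) (hl : 1 ≤ l) :
    BijOn (epsToCgf α l) (Ioo (0 : ℝ) (1 / l)) (Ioi 0) := by
  have hl' : (0 : ℝ) < l := by exact_mod_cast hl
  refine ⟨fun ε hε => epsToCgf_pos hα hl hε, fun ε hε δ hδ h => ?_, fun y hy => ?_⟩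
  · have h1 := one_sub_mul_pos hl hε
    have h2 := one_sub_mul_pos hl hδ
    have h3 : 0 < α * ε / (1 - l * ε) := div_pos (mul_pos hα hε.1) h1
    have h4 : 0 < α * δ / (1 - l * δ) := div_pos (mul_pos hα hδ.1) h2
    have h5 := Real.log_injOn_pos (show 0 < 1 + α * ε / (1 - l * ε) by linarith)
      (show 0 < 1 + α * δ / (1 - l * δ) by linarith) h
    have h6 := add_left_cancel h5
    rw [div_eq_div_iff h1.ne' h2.ne'] at h6
    have h7 : α * (ε - δ) = 0 := by linear_combination h6
    rcases mul_eq_zero.1 h7 with h8 | h8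
    · exact absurd h8 hα.ne'
    · linarith
  · have hy' : 0 < Real.exp y - 1 := exp_sub_one_pos hy
    have hden : 0 < α + l * (Real.exp y - 1) := by positivity
    refine ⟨(Real.exp y - 1) / (α + l * (Real.exp y - 1)), ⟨by positivity, ?_⟩, ?_⟩
    · rw [div_lt_div_iff₀ hden hl']
      linarith
    · have : 1 - l * ((Real.exp y - 1) / (α + l * (Real.exp y - 1)))
          = α / (α + l * (Real.exp y - 1)) := by
        field_simp
        ring
      rw [epsToCgf, this]
      have : 1 + α * ((Real.exp y - 1) / (α + l * (Real.exp y - 1)))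
          / (α / (α + l * (Real.exp y - 1))) = Real.exp y := by
        field_simp
        ring
      rw [this, Real.log_exp]

theorem bijOn_ewensH₂ (hα : 0 < α) (hl : 1 ≤ l) :
    BijOn (ewensH₂ α l) (Ioo (0 : ℝ) (1 / l)) univ := by
  have hV : BijOn (fun y => cgfEquation α l y - α * Real.log α) (Ioi 0) univ := by
    refine ⟨fun _ _ => mem_univ _, fun y hy z hz h => ?_, fun c _ => ?_⟩
    · exact (strictMonoOn_cgfEquation hα).injOn hy hz (by simpa using h)
    · obtain ⟨y, hy, h⟩ := surjOn_cgfEquation hα hl (mem_univ (c + α * Real.log α))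
      exact ⟨y, hy, by simp only [h]; ring⟩
  exact (hV.comp (bijOn_epsToCgf hα hl)).congr fun ε hε => (ewensH₂_eq hα hl hε).symm

end epsToCgf

section limitCgf

variable {α : ℝ} {l : ℕ}

lemma limitCgf_of_nonpos {t : ℝ} (ht : t ≤ 0) : limitCgf α l t = 0 := if_neg ht.not_gt

lemma limitCgf_spec (hα : α ∈ Ioo (0 : ℝ) 1) (hl : 1 ≤ l) {t : ℝ} (ht : 0 < t) :
    0 < limitCgf α l t ∧ cgfEquation α l (limitCgf α l t)
      = Real.log (stableWeight α l * (Real.exp t - 1)) := by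
  have hmem : epsZero α l t ∈ Ioo (0 : ℝ) (1 / l) ∧
      ewensH₂ α l (epsZero α l t) = ewensH₁ α l t :=
    Function.invFunOn_pos ((bijOn_ewensH₂ hα.1 hl).surjOn (mem_univ _))
  have hΛ : limitCgf α l t = epsToCgf α l (epsZero α l t) := if_pos ht
  have h1 : 0 < Real.exp t - 1 := exp_sub_one_pos ht
  have hp := stableWeight_pos hα l
  have hα' : 0 < α ^ α := Real.rpow_pos_of_pos hα.1 _
  refine ⟨hΛ ▸ epsToCgf_pos hα.1 hl hmem.1, ?_⟩
  have h2 := ewensH₂_eq hα.1 hl hmem.1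
  have h3 : α * (ascPochhammer ℝ (l - 1)).eval (1 - α) / (α ^ α * (l.factorial : ℝ))
      = stableWeight α l / α ^ α := by
    rw [stableWeight, div_div, mul_comm (α ^ α)]
  rw [hmem.2, ewensH₁, h3, Real.log_div h1.ne' (Real.exp_pos t).ne', Real.log_exp,
    Real.log_div hp.ne' hα'.ne', Real.log_rpow hα.1, ← hΛ] at h2
  rw [Real.log_mul hp.ne' h1.ne']
  linarith

lemma limitCgf_nonneg (hα : α ∈ Ioo (0 : ℝ) 1) (hl : 1 ≤ l) (t : ℝ) : 0 ≤ limitCgf α l t := by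
  rcases le_or_gt t 0 with ht | ht
  · exact (limitCgf_of_nonpos ht).ge
  · exact (limitCgf_spec hα hl ht).1.le

lemma limitCgf_eq_of_cgfEquation (hα : α ∈ Ioo (0 : ℝ) 1) (hl : 1 ≤ l) {t y : ℝ} (ht : 0 < t)
    (hy : 0 < y) (h : cgfEquation α l y = Real.log (stableWeight α l * (Real.exp t - 1))) :
    limitCgf α l t = y :=
  (strictMonoOn_cgfEquation hα.1).injOn (limitCgf_spec hα hl ht).1 hy
    ((limitCgf_spec hα hl ht).2.trans h.symm)

lemma strictMonoOn_limitCgf (hα : α ∈ Ioo (0 : ℝ) 1) (hl : 1 ≤ l) :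
    StrictMonoOn (limitCgf α l) (Ioi 0) := by
  intro s hs t ht hst
  have h1 := limitCgf_spec hα hl hs
  have h2 := limitCgf_spec hα hl ht
  rw [← (strictMonoOn_cgfEquation hα.1).lt_iff_lt h1.1 h2.1, h1.2, h2.2]
  have h3 : 0 < Real.exp s - 1 := exp_sub_one_pos hs
  have hp := stableWeight_pos hα l
  exact Real.log_lt_log (by positivity)
    (mul_lt_mul_of_pos_left (by linarith [Real.exp_lt_exp.2 hst]) hp)

/-- The equation in exponential form: `e^{-Λ}` is the zero of
`(1 - x) ^ α - (e^t - 1) p_l x ^ l`, the denominator of the generating function. -/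
lemma limitCgf_equation (hα : α ∈ Ioo (0 : ℝ) 1) (hl : 1 ≤ l) {t : ℝ} (ht : 0 < t) :
    (Real.exp t - 1) * stableWeight α l * Real.exp (-limitCgf α l t) ^ l
      = (1 - Real.exp (-limitCgf α l t)) ^ α := by
  obtain ⟨hy, h⟩ := limitCgf_spec hα hl ht
  set y := limitCgf α l t
  have h1 : 0 < Real.exp t - 1 := exp_sub_one_pos ht
  have hp := stableWeight_pos hα l
  have h2 := congrArg Real.exp h
  rw [Real.exp_log (by positivity), cgfEquation, Real.exp_add] at h2
  rw [Real.rpow_def_of_pos (one_sub_exp_neg_pos hy), mul_comm (Real.log _), ← Real.exp_nat_mul,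
    mul_comm (_ - _), ← h2, mul_right_comm, ← Real.exp_add]
  simp

/-- On `(0, ∞)` the limiting cumulant generating function is the inverse of the explicit function
`τ y = log (1 + exp (V y) / p_l)`, where `V` is `cgfEquation`, whose derivative is positive. -/
lemma hasDerivAt_limitCgf_of_pos (hα : α ∈ Ioo (0 : ℝ) 1) (hl : 1 ≤ l) {t : ℝ} (ht : 0 < t) :
    ∃ d, HasDerivAt (limitCgf α l) d t := by
  have hp := stableWeight_pos hα l
  let τ : ℝ → ℝ := fun y => Real.log (1 + Real.exp (cgfEquation α l y) / stableWeight α l)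
  have hτΛ : ∀ s > 0, τ (limitCgf α l s) = s := by
    intro s hs
    have h1 : 0 < Real.exp s - 1 := exp_sub_one_pos hs
    simp only [τ]
    rw [(limitCgf_spec hα hl hs).2, Real.exp_log (by positivity), mul_div_cancel_left₀ _ hp.ne',
      add_sub_cancel, Real.log_exp]
  have hcont : ContinuousAt (limitCgf α l) t := by
    refine (strictMonoOn_limitCgf hα hl).continuousAt_of_image_mem_nhds (Ioi_mem_nhds ht) ?_
    refine mem_of_superset (Ioi_mem_nhds (limitCgf_spec hα hl ht).1) fun y hy => ?_
    have hpos : 0 < Real.exp (cgfEquation α l y) / stableWeight α l := by positivity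
    refine ⟨τ y, Real.log_pos (by linarith), limitCgf_eq_of_cgfEquation hα hl
      (Real.log_pos (by linarith)) hy ?_⟩
    simp only [τ]
    rw [Real.exp_log (by linarith), add_sub_cancel_left, mul_div_cancel₀ _ hp.ne', Real.log_exp]
  have hy := (limitCgf_spec hα hl ht).1
  have hpos : 0 < Real.exp (cgfEquation α l (limitCgf α l t)) / stableWeight α l := by positivity
  have hderiv := (((hasDerivAt_cgfEquation α l hy).exp.div_const (stableWeight α l)).const_add
    1).log (by linarith)
  refine ⟨_, HasDerivAt.of_local_left_inverse hcont hderiv ?_ ?_⟩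
  · have h1 := one_sub_exp_neg_pos hy
    have hl' : (0 : ℝ) < l := by exact_mod_cast hl
    have := hα.1
    positivity
  · filter_upwards [Ioi_mem_nhds ht] with s hs using hτΛ s hs

/-- The limiting cumulant generating function is `o(t)` at the origin: it is of order
`t ^ (1 / α)` with `1 / α > 1`. -/
lemma hasDerivAt_limitCgf_zero (hα : α ∈ Ioo (0 : ℝ) 1) (hl : 1 ≤ l) :
    HasDerivAt (limitCgf α l) 0 0 := by
  have hp := stableWeight_pos hα l
  rw [hasDerivAt_iff_isLittleO, Asymptotics.isLittleO_iff]
  intro η hη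
  simp only [limitCgf_of_nonpos le_rfl, sub_zero, smul_zero, Real.norm_eq_abs]
  -- for small `t > 0`, `e^t - 1 ≤ 2 t` and `1 - e^{-η t} ≥ η t / 2`
  have h1 : ∀ᶠ t : ℝ in 𝓝 0, t < 1 := eventually_lt_nhds one_pos
  have h2 : ∀ᶠ t : ℝ in 𝓝 0, η * t < 1 / 2 := by
    have : ContinuousAt (fun t : ℝ => η * t) 0 := by fun_prop
    exact this.eventually (eventually_lt_nhds (by simp))
  have h3 : ∀ᶠ t : ℝ in 𝓝 0, stableWeight α l * 2 * t ^ (1 - α) < (η / 2) ^ α := by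
    have : ContinuousAt (fun t : ℝ => stableWeight α l * 2 * t ^ (1 - α)) 0 :=
      ((Real.continuousAt_rpow_const 0 (1 - α) (Or.inr (by linarith [hα.2])))).const_mul _
    refine this.eventually (eventually_lt_nhds ?_)
    simp only [Real.zero_rpow (show 1 - α ≠ 0 by linarith [hα.2]), mul_zero]
    positivity
  filter_upwards [h1, h2, h3] with t ht1 ht2 ht3
  rcases le_or_gt t 0 with ht | ht
  · rw [limitCgf_of_nonpos ht, abs_zero]
    positivity
  rw [abs_of_nonneg (limitCgf_nonneg hα hl t), abs_of_pos ht]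
  have hηt : 0 < η * t := by positivity
  obtain ⟨hy, h⟩ := limitCgf_spec hα hl ht
  refine ((strictMonoOn_cgfEquation (l := l) hα.1).le_iff_le hy hηt).1 ?_
  rw [h]
  have h4 : Real.exp t - 1 ≤ 2 * t := by
    have h := Real.abs_exp_sub_one_sub_id_le (show |t| ≤ 1 by rw [abs_of_pos ht]; exact ht1.le)
    have := (abs_le.1 h).2
    nlinarith
  have h5 : η * t / 2 ≤ 1 - Real.exp (-(η * t)) := by
    have h := Real.abs_exp_sub_one_sub_id_le (x := -(η * t))
      (show |-(η * t)| ≤ 1 by rw [abs_neg, abs_of_pos hηt]; linarith)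
    have := (abs_le.1 h).2
    nlinarith
  have h6 : 0 < Real.exp t - 1 := exp_sub_one_pos ht
  have h7 : stableWeight α l * (Real.exp t - 1) ≤ (η * t / 2) ^ α := by
    calc stableWeight α l * (Real.exp t - 1) ≤ stableWeight α l * (2 * t) := by gcongr
      _ = stableWeight α l * 2 * t ^ (1 - α) * t ^ α := by
          rw [mul_assoc _ (t ^ (1 - α)), ← Real.rpow_add ht, sub_add_cancel, Real.rpow_one]
          ring
      _ ≤ (η / 2) ^ α * t ^ α := by gcongr
      _ = (η * t / 2) ^ α := by
          rw [← Real.mul_rpow (by positivity) ht.le]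
          ring_nf
  have h8 : Real.log (stableWeight α l * (Real.exp t - 1))
      ≤ α * Real.log (1 - Real.exp (-(η * t))) := by
    rw [← Real.log_rpow (one_sub_exp_neg_pos hηt)]
    refine Real.log_le_log (by positivity) (h7.trans ?_)
    exact Real.rpow_le_rpow (by positivity) h5 hα.1.le
  have h9 : 0 ≤ (l : ℝ) * (η * t) := by positivity
  rw [cgfEquation]
  linarith

lemma exists_hasDerivAt_limitCgf (hα : α ∈ Ioo (0 : ℝ) 1) (hl : 1 ≤ l) (t : ℝ) :
    ∃ d, HasDerivAt (limitCgf α l) d t := by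
  rcases lt_trichotomy t 0 with ht | rfl | ht
  · refine ⟨0, (hasDerivAt_const t (0 : ℝ)).congr_of_eventuallyEq ?_⟩
    filter_upwards [Iio_mem_nhds ht] with s hs using limitCgf_of_nonpos (le_of_lt hs)
  · exact ⟨0, hasDerivAt_limitCgf_zero hα hl⟩
  · exact hasDerivAt_limitCgf_of_pos hα hl ht

lemma exists_le_limitCgf (hα : α ∈ Ioo (0 : ℝ) 1) (hl : 1 ≤ l) :
    ∃ C, ∀ t, 1 / l * t - C ≤ limitCgf α l t := by
  have hp := stableWeight_pos hα l
  have hl' : (0 : ℝ) < l := by exact_mod_cast hl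
  refine ⟨max (1 / l) (-Real.log (stableWeight α l / 2) / l), fun t => ?_⟩
  rcases le_or_gt t 1 with ht | ht
  · have h1 : 1 / (l : ℝ) * t ≤ 1 / l := mul_le_of_le_one_right (by positivity) ht
    linarith [le_max_left (1 / (l : ℝ)) (-Real.log (stableWeight α l / 2) / l),
      limitCgf_nonneg hα hl t]
  · obtain ⟨hy, h⟩ := limitCgf_spec hα hl (one_pos.trans ht)
    have h1 : Real.exp t / 2 ≤ Real.exp t - 1 := by
      have := Real.add_one_le_exp t
      linarith
    have h2 : Real.log (1 - Real.exp (-limitCgf α l t)) ≤ 0 :=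
      Real.log_nonpos (one_sub_exp_neg_pos hy).le (by linarith [Real.exp_pos (-limitCgf α l t)])
    have h3 : Real.log (stableWeight α l / 2) + t
        ≤ Real.log (stableWeight α l * (Real.exp t - 1)) := by
      conv_lhs => rw [← Real.log_exp t, ← Real.log_mul (by positivity) (by positivity)]
      refine Real.log_le_log (by positivity) ?_
      have := mul_le_mul_of_nonneg_left h1 hp.le
      linarith
    rw [← h, cgfEquation] at h3
    have h4 := mul_nonpos_of_nonneg_of_nonpos hα.1.le h2
    have h5 : (Real.log (stableWeight α l / 2) + t) / l ≤ limitCgf α l t := by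
      rw [div_le_iff₀ hl']
      linarith
    have h6 := le_max_right (1 / (l : ℝ)) (-Real.log (stableWeight α l / 2) / l)
    have h7 : (Real.log (stableWeight α l / 2) + t) / l
        = 1 / l * t - -Real.log (stableWeight α l / 2) / l := by ring
    linarith

end limitCgf

/-! ### Legendre transforms on the half-line -/

/-- The Legendre transform of `Λ`, with values in the extended reals. -/
noncomputable def legendre (Λ : ℝ → ℝ) (x : ℝ) : EReal :=
  ⨆ t : ℝ, ((t * x - Λ t : ℝ) : EReal)

section legendre

variable {Λ : ℝ → ℝ} {b : ℝ}

lemma le_legendre (Λ : ℝ → ℝ) (t x : ℝ) : ((t * x - Λ t : ℝ) : EReal) ≤ legendre Λ x :=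
  le_iSup (fun t : ℝ => ((t * x - Λ t : ℝ) : EReal)) t

lemma legendre_nonneg (h0 : Λ 0 = 0) (x : ℝ) : 0 ≤ legendre Λ x := by
  simpa [h0] using le_legendre Λ 0 x

lemma lowerSemicontinuous_legendre (Λ : ℝ → ℝ) : LowerSemicontinuous (legendre Λ) := by
  refine lowerSemicontinuous_iSup fun t => Continuous.lowerSemicontinuous ?_
  exact continuous_coe_real_ereal.comp (by fun_prop)

lemma legendre_zero (h0 : Λ 0 = 0) (hnn : ∀ t, 0 ≤ Λ t) : legendre Λ 0 = 0 := by
  refine le_antisymm (iSup_le fun t => ?_) (legendre_nonneg h0 0)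
  exact_mod_cast (by simpa using hnn t : t * 0 - Λ t ≤ 0)

lemma legendre_eq_top_of_neg (h0 : ∀ t ≤ 0, Λ t = 0) {x : ℝ} (hx : x < 0) :
    legendre Λ x = ⊤ := by
  refine (EReal.eq_top_iff_forall_lt _).2 fun c => ?_
  refine lt_of_lt_of_le ?_ (le_legendre Λ ((|c| + 1) / x) x)
  rw [h0 _ (div_nonpos_of_nonneg_of_nonpos (by positivity) hx.le), div_mul_cancel₀ _ hx.ne]
  exact_mod_cast (by linarith [le_abs_self c] : c < |c| + 1 - 0)

lemma legendre_eq_top_of_lt (hup : ∀ t, 0 ≤ t → Λ t ≤ b * t) {x : ℝ} (hx : b < x) :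
    legendre Λ x = ⊤ := by
  refine (EReal.eq_top_iff_forall_lt _).2 fun c => ?_
  have hx' : 0 < x - b := by linarith
  refine lt_of_lt_of_le ?_ (le_legendre Λ ((|c| + 1) / (x - b)) x)
  have h1 := hup ((|c| + 1) / (x - b)) (by positivity)
  have h2 : (|c| + 1) / (x - b) * (x - b) = |c| + 1 := div_mul_cancel₀ _ hx'.ne'
  rw [EReal.coe_lt_coe_iff]
  linarith [le_abs_self c]

lemma legendre_lt_top (h0 : ∀ t ≤ 0, Λ t = 0) {C : ℝ} (hlow : ∀ t, b * t - C ≤ Λ t) {x : ℝ}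
    (hx : x ∈ Icc 0 b) : legendre Λ x < ⊤ := by
  refine lt_of_le_of_lt (iSup_le fun t => ?_) (EReal.coe_lt_top (max C 0))
  rw [EReal.coe_le_coe_iff]
  rcases le_or_gt t 0 with ht | ht
  · rw [h0 t ht]
    linarith [mul_nonpos_of_nonpos_of_nonneg ht hx.1, le_max_right C 0]
  · linarith [mul_le_mul_of_nonneg_left hx.2 ht.le, hlow t, le_max_left C 0]

lemma monotoneOn_legendre (h0 : ∀ t ≤ 0, Λ t = 0) : MonotoneOn (legendre Λ) (Ici 0) := by
  intro x hx y hy hxy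
  refine iSup_le fun t => ?_
  rcases le_or_gt t 0 with ht | ht
  · refine le_trans ?_ (legendre_nonneg (h0 0 le_rfl) y)
    have := mul_nonpos_of_nonpos_of_nonneg ht hx
    exact_mod_cast (by rw [h0 t ht]; linarith : t * x - Λ t ≤ 0)
  · refine le_trans ?_ (le_legendre Λ t y)
    rw [EReal.coe_le_coe_iff]
    linarith [mul_le_mul_of_nonneg_left hxy ht.le]

lemma isGoodRateFunction_legendre (h0 : ∀ t ≤ 0, Λ t = 0)
    (hup : ∀ t, 0 ≤ t → Λ t ≤ b * t) : IsGoodRateFunction (legendre Λ) where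
  nonneg := legendre_nonneg (h0 0 le_rfl)
  lowerSemicontinuous := lowerSemicontinuous_legendre Λ
  isCompact_sublevel c := by
    refine isCompact_Icc.of_isClosed_subset
      ((lowerSemicontinuous_legendre Λ).isClosed_preimage (c : EReal)) (fun x hx => ?_)
      (s := Icc 0 b)
    have hx' : legendre Λ x < ⊤ := lt_of_le_of_lt hx (EReal.coe_lt_top c)
    refine ⟨?_, ?_⟩
    · by_contra! h
      exact hx'.ne (legendre_eq_top_of_neg h0 h)
    · by_contra! h
      exact hx'.ne (legendre_eq_top_of_lt hup h)

/-- Every interior point is a slope of `Λ`: `t ↦ Λ t - t x` tends to infinity in both directions,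
hence has a minimum. -/
lemma exists_hasDerivAt_eq (h0 : ∀ t ≤ 0, Λ t = 0) (hd : ∀ t, ∃ d, HasDerivAt Λ d t) {C : ℝ}
    (hlow : ∀ t, b * t - C ≤ Λ t) {x : ℝ} (hx : x ∈ Ioo 0 b) : ∃ t, HasDerivAt Λ x t := by
  have hcont : Continuous fun t => Λ t - t * x := by
    have : Continuous Λ := continuous_iff_continuousAt.2 fun t => (hd t).choose_spec.continuousAt
    fun_prop
  have hlim : Tendsto (fun t => Λ t - t * x) (cocompact ℝ) atTop := by
    rw [cocompact_eq_atBot_atTop, tendsto_sup]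
    constructor
    · refine (tendsto_id.atBot_mul_const_of_neg (show -x < 0 by linarith [hx.1])).congr' ?_
      filter_upwards [eventually_le_atBot 0] with t ht
      rw [h0 t ht]
      simp
    · refine tendsto_atTop_mono (f := fun t => t * (b - x) - C) (fun t => ?_) ?_
      · linarith [hlow t]
      · exact tendsto_atTop_add_const_right _ (-C)
          (tendsto_id.atTop_mul_const (show 0 < b - x by linarith [hx.2]))
  obtain ⟨t, ht⟩ := hcont.exists_forall_le hlim
  obtain ⟨d, hd⟩ := hd t
  have h1 : HasDerivAt (fun t => Λ t - t * x) (d - 1 * x) t :=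
    hd.sub ((hasDerivAt_id t).mul_const x)
  have h2 := IsLocalMin.hasDerivAt_eq_zero (Eventually.of_forall ht) h1
  refine ⟨t, ?_⟩
  rwa [show x = d by linarith]

end legendre

/-! ### A Gärtner–Ellis theorem for bounded nonnegative variables -/

section GartnerEllis

variable {Ω : Type*} [MeasurableSpace Ω] {P : Measure Ω}

lemma log_measure_div_mono {A B : Set Ω} (h : A ⊆ B) (n : ℕ) :
    ENNReal.log (P A) / ((n : ℝ) : EReal) ≤ ENNReal.log (P B) / ((n : ℝ) : EReal) :=
  EReal.div_le_div_right_of_nonneg (by exact_mod_cast n.cast_nonneg (α := ℝ))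
    (ENNReal.log_le_log (measure_mono h))

variable [IsProbabilityMeasure P]

lemma log_measure_div_le {A : Set Ω} {n : ℕ} (hn : 0 < n) {c : ℝ}
    (h : P.real A ≤ Real.exp (n * c)) :
    ENNReal.log (P A) / ((n : ℝ) : EReal) ≤ (c : EReal) := by
  have hn' : (0 : ℝ) < n := by exact_mod_cast hn
  rw [EReal.div_le_iff_le_mul (by exact_mod_cast hn') (EReal.coe_ne_top _),
    ← ofReal_measureReal (measure_ne_top P A)]
  refine (ENNReal.log_le_log (ENNReal.ofReal_le_ofReal h)).trans ?_
  rw [ENNReal.log_ofReal_of_pos (Real.exp_pos _), Real.log_exp]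
  exact le_of_eq (by push_cast; ring_nf)

lemma le_log_measure_div {A : Set Ω} {n : ℕ} (hn : 0 < n) {c : ℝ}
    (h : Real.exp (n * c) ≤ P.real A) :
    (c : EReal) ≤ ENNReal.log (P A) / ((n : ℝ) : EReal) := by
  have hn' : (0 : ℝ) < n := by exact_mod_cast hn
  rw [EReal.le_div_iff_mul_le (by exact_mod_cast hn') (EReal.coe_ne_top _),
    ← ofReal_measureReal (measure_ne_top P A)]
  refine le_trans ?_ (ENNReal.log_le_log (ENNReal.ofReal_le_ofReal h))
  rw [ENNReal.log_ofReal_of_pos (Real.exp_pos _), Real.log_exp]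
  exact le_of_eq (by push_cast; rw [mul_comm])

variable {S : ℕ → Ω → ℝ} {Λ : ℝ → ℝ} {b : ℝ}

lemma integrable_exp_mul_of_bounded {Y : Ω → ℝ} (hY : Measurable Y) {K : ℝ}
    (hK : ∀ ω, Y ω ∈ Icc 0 K) (t : ℝ) : Integrable (fun ω => Real.exp (t * Y ω)) P := by
  refine Integrable.of_bound (by fun_prop) (Real.exp (|t| * K)) (ae_of_all _ fun ω => ?_)
  rw [Real.norm_eq_abs, Real.abs_exp]
  refine Real.exp_le_exp.2 ?_
  calc t * Y ω ≤ |t| * Y ω := mul_le_mul_of_nonneg_right (le_abs_self t) (hK ω).1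
    _ ≤ |t| * K := mul_le_mul_of_nonneg_left (hK ω).2 (abs_nonneg t)

lemma cgf_limit_le (hS : ∀ n, Measurable (S n)) (hb : ∀ (n : ℕ) ω, S n ω ∈ Icc 0 (b * n))
    (hΛ : ∀ t, Tendsto (fun n : ℕ => cgf (S n) P t / n) atTop (𝓝 (Λ t))) {t : ℝ} (ht : 0 ≤ t) :
    Λ t ≤ b * t := by
  refine le_of_tendsto (hΛ t) ?_
  filter_upwards [eventually_gt_atTop 0] with n hn
  have hn' : (0 : ℝ) < n := by exact_mod_cast hn
  have hint := integrable_exp_mul_of_bounded (P := P) (hS n) (hb n) t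
  have h1 : mgf (S n) P t ≤ Real.exp (t * (b * n)) := by
    have h := integral_mono hint (integrable_const (μ := P) (Real.exp (t * (b * n)))) fun ω =>
      Real.exp_le_exp.2 (mul_le_mul_of_nonneg_left (hb n ω).2 ht)
    simpa [mgf] using h
  rw [div_le_iff₀ hn', cgf]
  have := Real.log_le_log (mgf_pos hint) h1
  rw [Real.log_exp] at this
  linarith

lemma limsup_upper_tail_le (hS : ∀ n, Measurable (S n)) (hb : ∀ (n : ℕ) ω, S n ω ∈ Icc 0 (b * n))
    (hΛ : ∀ t, Tendsto (fun n : ℕ => cgf (S n) P t / n) atTop (𝓝 (Λ t)))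
    (h0 : ∀ t ≤ 0, Λ t = 0) {a : ℝ} (ha : 0 ≤ a) :
    limsup (fun n : ℕ => ENNReal.log (P {ω | a ≤ S n ω / n}) / ((n : ℝ) : EReal)) atTop
      ≤ -legendre Λ a := by
  have hzero : limsup (fun n : ℕ => ENNReal.log (P {ω | a ≤ S n ω / n}) / ((n : ℝ) : EReal)) atTop
      ≤ ((0 : ℝ) : EReal) := by
    refine limsup_le_of_le (h := ?_)
    filter_upwards [eventually_gt_atTop 0] with n hn
    exact log_measure_div_le hn (by simp [measureReal_le_one])
  rw [EReal.le_neg]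
  refine iSup_le fun t => ?_
  rw [EReal.le_neg, ← EReal.coe_neg]
  rcases le_or_gt t 0 with ht | ht
  · refine hzero.trans ?_
    rw [EReal.coe_le_coe_iff, h0 t ht]
    linarith [mul_nonpos_of_nonpos_of_nonneg ht ha]
  · have hlim : Tendsto (fun n : ℕ => ((cgf (S n) P t / n - t * a : ℝ) : EReal)) atTop
        (𝓝 ((-(t * a - Λ t) : ℝ) : EReal)) := by
      rw [EReal.tendsto_coe, neg_sub]
      exact (hΛ t).sub_const _
    rw [← hlim.limsup_eq]
    refine limsup_le_limsup ?_
    filter_upwards [eventually_gt_atTop 0] with n hn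
    have hn' : (0 : ℝ) < n := by exact_mod_cast hn
    refine log_measure_div_le hn ?_
    have h := measure_ge_le_exp_cgf (X := S n) (μ := P) (a * n) ht.le
      (integrable_exp_mul_of_bounded (hS n) (hb n) t)
    have e : (n : ℝ) * (cgf (S n) P t / n - t * a) = -t * (a * n) + cgf (S n) P t := by
      field_simp
      ring
    simpa only [e, le_div_iff₀ hn'] using h

/-- Exponential tilting: if `Λ` has slope `x` at `t`, then under the law tilted by `t` the averages
concentrate around `x`, because `Λ (t ± s) - Λ t` is smaller than `± s (x ± δ)` for small `s`. -/
lemma le_liminf_ball (hS : ∀ n, Measurable (S n)) (hb : ∀ (n : ℕ) ω, S n ω ∈ Icc 0 (b * n))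
    (hΛ : ∀ t, Tendsto (fun n : ℕ => cgf (S n) P t / n) atTop (𝓝 (Λ t))) {t x : ℝ}
    (ht : HasDerivAt Λ x t) {δ : ℝ} (hδ : 0 < δ) :
    ((Λ t - t * x - |t| * δ : ℝ) : EReal)
      ≤ liminf (fun n : ℕ => ENNReal.log (P {ω | S n ω / n ∈ Metric.ball x δ})
          / ((n : ℝ) : EReal)) atTop := by
  obtain ⟨s, hs, hs1, hs2⟩ : ∃ s > 0, Λ (t + s) - Λ t < s * (x + δ) ∧
      Λ (t - s) - Λ t < -s * (x - δ) := by
    have h1 := (hasDerivAt_iff_isLittleO_nhds_zero.1 ht).def (half_pos hδ)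
    have h2 : ∀ᶠ s in 𝓝 (0 : ℝ), ‖Λ (t + -s) - Λ t - (-s) • x‖ ≤ δ / 2 * ‖-s‖ := by
      have : Tendsto (fun s : ℝ => -s) (𝓝 0) (𝓝 0) := by
        simpa using (continuous_neg (G := ℝ)).tendsto 0
      exact this.eventually h1
    obtain ⟨s, ⟨h3, h4⟩, hs⟩ := (((h1.and h2).filter_mono nhdsWithin_le_nhds).and
      (eventually_mem_nhdsWithin (a := (0 : ℝ)) (s := Ioi 0))).exists
    have hs' : (0 : ℝ) < s := hs
    simp only [Real.norm_eq_abs, smul_eq_mul, abs_neg, abs_of_pos hs', ← sub_eq_add_neg] at h3 h4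
    have h5 := (abs_le.1 h3).2
    have h6 := (abs_le.1 h4).2
    have := mul_pos hs' hδ
    exact ⟨s, hs', by linarith, by linarith⟩
  -- the two tails contribute at most half of the moment generating function at `t`
  have hev : ∀ u c : ℝ, Λ u - Λ t < c → ∀ᶠ n : ℕ in atTop,
      Real.exp (-(n * c)) * mgf (S n) P u ≤ mgf (S n) P t / 4 := by
    intro u c huc
    have hlim := ((hΛ u).sub (hΛ t)).sub_const c
    have hneg : Λ u - Λ t - c < (Λ u - Λ t - c) / 2 := by linarith
    have hlog : ∀ᶠ n : ℕ in atTop, Real.log 4 ≤ n * ((c - (Λ u - Λ t)) / 2) :=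
      (tendsto_natCast_atTop_atTop.atTop_mul_const
        (show 0 < (c - (Λ u - Λ t)) / 2 by linarith)).eventually_ge_atTop _
    filter_upwards [hlim.eventually (gt_mem_nhds hneg), eventually_gt_atTop 0, hlog]
      with n h1 hn h2
    have hn' : (0 : ℝ) < n := by exact_mod_cast hn
    rw [← exp_cgf (integrable_exp_mul_of_bounded (P := P) (hS n) (hb n) u),
      ← exp_cgf (integrable_exp_mul_of_bounded (P := P) (hS n) (hb n) t), ← Real.exp_add]
    have h4 : Real.exp (cgf (S n) P t) / 4 = Real.exp (cgf (S n) P t - Real.log 4) := by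
      rw [Real.exp_sub, Real.exp_log (by norm_num)]
    rw [h4, Real.exp_le_exp]
    have h3 : cgf (S n) P u - cgf (S n) P t - n * c ≤ n * ((Λ u - Λ t - c) / 2) := by
      have := mul_le_mul_of_nonneg_left h1.le hn'.le
      have e : (n : ℝ) * (cgf (S n) P u / n - cgf (S n) P t / n - c)
          = cgf (S n) P u - cgf (S n) P t - n * c := by
        field_simp
      rwa [e] at this
    linarith
  have hlim : Tendsto (fun n : ℕ =>
      ((cgf (S n) P t / n - Real.log 2 / n - t * x - |t| * δ : ℝ) : EReal)) atTop
      (𝓝 ((Λ t - t * x - |t| * δ : ℝ) : EReal)) := by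
    rw [EReal.tendsto_coe]
    have h2 : Tendsto (fun n : ℕ => Real.log 2 / n) atTop (𝓝 0) :=
      tendsto_const_nhds.div_atTop tendsto_natCast_atTop_atTop
    have := (((hΛ t).sub h2).sub_const (t * x)).sub_const (|t| * δ)
    rwa [sub_zero] at this
  rw [← hlim.liminf_eq]
  refine liminf_le_liminf ?_
  filter_upwards [hev (t + s) (s * (x + δ)) hs1, hev (t - s) (-s * (x - δ)) hs2,
    eventually_gt_atTop 0] with n hn1 hn2 hn
  have hn' : (0 : ℝ) < n := by exact_mod_cast hn
  refine le_log_measure_div hn ?_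
  set A := {ω | S n ω / n ∈ Metric.ball x δ} with hA
  have hAm : MeasurableSet A := ((hS n).div_const _) measurableSet_ball
  have hint : ∀ u, Integrable (fun ω => Real.exp (u * S n ω)) P :=
    fun u => integrable_exp_mul_of_bounded (hS n) (hb n) u
  set K := Real.exp (n * (t * x + |t| * δ)) with hK
  have hpt : ∀ ω, Real.exp (t * S n ω) ≤ A.indicator (fun _ => K) ω
      + Real.exp (-(n * (s * (x + δ)))) * Real.exp ((t + s) * S n ω)
      + Real.exp (-(n * (-s * (x - δ)))) * Real.exp ((t - s) * S n ω) := by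
    intro ω
    rw [← Real.exp_add, ← Real.exp_add]
    have e1 := Real.exp_pos (-(n * (s * (x + δ))) + (t + s) * S n ω)
    have e2 := Real.exp_pos (-(n * (-s * (x - δ))) + (t - s) * S n ω)
    by_cases hω : ω ∈ A
    · rw [indicator_of_mem hω]
      have h1 : |S n ω / n - x| < δ := by simpa [hA, Real.dist_eq] using hω
      have h2 : t * S n ω ≤ n * (t * x + |t| * δ) := by
        have h3 : t * (S n ω / n - x) ≤ |t| * δ :=
          (le_abs_self _).trans (by rw [abs_mul]; gcongr)
        have h4 := mul_le_mul_of_nonneg_left h3 hn'.le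
        have h5 : (n : ℝ) * (t * (S n ω / n - x)) = t * S n ω - n * (t * x) := by field_simp
        linarith
      have := Real.exp_le_exp.2 h2
      linarith
    · rw [indicator_of_notMem hω]
      have h1 : δ ≤ |S n ω / n - x| := by simpa [hA, Real.dist_eq] using hω
      rcases le_abs.1 h1 with h | h
      · have h2 : (x + δ) * n ≤ S n ω := by rw [← le_div_iff₀ hn']; linarith
        have h3 := mul_le_mul_of_nonneg_left h2 hs.le
        have := Real.exp_le_exp.2 (show t * S n ω ≤ -(n * (s * (x + δ))) + (t + s) * S n ω by
          linarith)
        linarith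
      · have h2 : S n ω ≤ (x - δ) * n := by rw [← div_le_iff₀ hn']; linarith
        have h3 := mul_le_mul_of_nonneg_left h2 hs.le
        have := Real.exp_le_exp.2 (show t * S n ω ≤ -(n * (-s * (x - δ))) + (t - s) * S n ω by
          linarith)
        linarith
  have hI : mgf (S n) P t ≤ P.real A * K
      + Real.exp (-(n * (s * (x + δ)))) * mgf (S n) P (t + s)
      + Real.exp (-(n * (-s * (x - δ)))) * mgf (S n) P (t - s) := by
    have h1 : Integrable (A.indicator fun _ => K) P := (integrable_const K).indicator hAm
    have h2 := (hint (t + s)).const_mul (Real.exp (-(n * (s * (x + δ)))))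
    have h3 := (hint (t - s)).const_mul (Real.exp (-(n * (-s * (x - δ)))))
    have h := integral_mono (hint t) ((h1.add h2).add h3) hpt
    rw [integral_add' (h1.add h2) h3, integral_add' h1 h2, integral_const_mul,
      integral_const_mul, integral_indicator_const _ hAm, smul_eq_mul] at h
    exact h
  have hhalf : mgf (S n) P t / 2 ≤ P.real A * K := by linarith
  rw [← exp_cgf (hint t)] at hhalf
  have hfin : Real.exp (n * (cgf (S n) P t / n - Real.log 2 / n - t * x - |t| * δ))
      = Real.exp (cgf (S n) P t) / 2 / K := by
    rw [hK, ← Real.exp_log (show (0 : ℝ) < 2 by norm_num), ← Real.exp_sub, ← Real.exp_sub,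
      Real.exp_log (show (0 : ℝ) < 2 by norm_num)]
    congr 1
    field_simp
    ring
  rw [hfin, div_le_iff₀ (Real.exp_pos _)]
  exact hhalf

lemma neg_legendre_le_liminf_of_hasDerivAt (hS : ∀ n, Measurable (S n))
    (hb : ∀ (n : ℕ) ω, S n ω ∈ Icc 0 (b * n))
    (hΛ : ∀ t, Tendsto (fun n : ℕ => cgf (S n) P t / n) atTop (𝓝 (Λ t))) {t x : ℝ}
    (ht : HasDerivAt Λ x t) {G : Set ℝ} (hG : IsOpen G) (hx : x ∈ G) :
    -legendre Λ x ≤ liminf (fun n : ℕ => ENNReal.log (P {ω | S n ω / n ∈ G})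
      / ((n : ℝ) : EReal)) atTop := by
  have h1 : -legendre Λ x ≤ ((Λ t - t * x : ℝ) : EReal) := by
    rw [EReal.neg_le, ← EReal.coe_neg, neg_sub]
    exact le_legendre Λ t x
  refine h1.trans ?_
  have hlim : Tendsto (fun δ : ℝ => ((Λ t - t * x - |t| * δ : ℝ) : EReal)) (𝓝[>] 0)
      (𝓝 ((Λ t - t * x : ℝ) : EReal)) := by
    rw [EReal.tendsto_coe]
    have : Continuous fun δ : ℝ => Λ t - t * x - |t| * δ := by fun_prop
    simpa using (this.tendsto 0).mono_left (nhdsWithin_le_nhds (s := Ioi 0))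
  refine le_of_tendsto hlim ?_
  obtain ⟨r, hr, hrG⟩ := Metric.isOpen_iff.1 hG x hx
  filter_upwards [Ioo_mem_nhdsGT hr] with δ hδ
  refine (le_liminf_ball hS hb hΛ ht hδ.1).trans
    (liminf_le_liminf (Eventually.of_forall fun n => ?_))
  refine log_measure_div_mono (fun ω hω => ?_) n
  exact hrG (Metric.ball_subset_ball hδ.2.le hω)

lemma neg_legendre_le_liminf (hS : ∀ n, Measurable (S n))
    (hb : ∀ (n : ℕ) ω, S n ω ∈ Icc 0 (b * n))
    (hΛ : ∀ t, Tendsto (fun n : ℕ => cgf (S n) P t / n) atTop (𝓝 (Λ t)))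
    (h0 : ∀ t ≤ 0, Λ t = 0) (hd0 : HasDerivAt Λ 0 0) (hd : ∀ t, ∃ d, HasDerivAt Λ d t) {C : ℝ}
    (hlow : ∀ t, b * t - C ≤ Λ t) {x : ℝ} {G : Set ℝ} (hG : IsOpen G) (hx : x ∈ G) :
    -legendre Λ x ≤ liminf (fun n : ℕ => ENNReal.log (P {ω | S n ω / n ∈ G})
      / ((n : ℝ) : EReal)) atTop := by
  rcases lt_trichotomy x 0 with hx0 | rfl | hx0
  · rw [legendre_eq_top_of_neg h0 hx0]
    simp
  · exact neg_legendre_le_liminf_of_hasDerivAt hS hb hΛ hd0 hG hx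
  rcases lt_trichotomy x b with hxb | rfl | hxb
  · obtain ⟨t, ht⟩ := exists_hasDerivAt_eq h0 hd hlow ⟨hx0, hxb⟩
    exact neg_legendre_le_liminf_of_hasDerivAt hS hb hΛ ht hG hx
  · -- the right end point is approached from inside, where the rate is smaller
    obtain ⟨y, hyG, hy⟩ : ∃ y ∈ G, y ∈ Ioo 0 x :=
      Filter.Eventually.exists (f := 𝓝[<] x)
        (inter_mem (mem_nhdsWithin_of_mem_nhds (hG.mem_nhds hx)) (Ioo_mem_nhdsLT hx0))
    obtain ⟨t, ht⟩ := exists_hasDerivAt_eq h0 hd hlow hy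
    refine le_trans ?_ (neg_legendre_le_liminf_of_hasDerivAt hS hb hΛ ht hG hyG)
    exact EReal.neg_le_neg_iff.2 (monotoneOn_legendre h0 hy.1.le hx0.le hy.2.le)
  · rw [legendre_eq_top_of_lt (fun t ht => cgf_limit_le hS hb hΛ ht) hxb]
    simp

theorem satisfiesLDP_legendre (hS : ∀ n, Measurable (S n))
    (hb : ∀ (n : ℕ) ω, S n ω ∈ Icc 0 (b * n))
    (hΛ : ∀ t, Tendsto (fun n : ℕ => cgf (S n) P t / n) atTop (𝓝 (Λ t)))
    (h0 : ∀ t ≤ 0, Λ t = 0) (hd0 : HasDerivAt Λ 0 0) (hd : ∀ t, ∃ d, HasDerivAt Λ d t) {C : ℝ}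
    (hlow : ∀ t, b * t - C ≤ Λ t) :
    SatisfiesLDP P (fun n ω => S n ω / n) (fun n => (n : ℝ)) (legendre Λ) where
  speed := tendsto_natCast_atTop_atTop
  upper_bound F hF := by
    have hnn : ∀ (n : ℕ) ω, 0 ≤ S n ω / n := fun n ω => div_nonneg (hb n ω).1 n.cast_nonneg
    rcases (F ∩ Ici 0).eq_empty_or_nonempty with he | hne
    · have hempty : ∀ n : ℕ, {ω | S n ω / n ∈ F} = ∅ := fun n =>
        eq_empty_of_forall_notMem fun ω hω => (he ▸ (⟨hω, hnn n ω⟩ : S n ω / n ∈ F ∩ Ici 0) :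
          S n ω / n ∈ (∅ : Set ℝ))
      refine limsup_le_of_le (h := ?_)
      filter_upwards [eventually_gt_atTop 0] with n hn
      have hn' : (0 : ℝ) < n := by exact_mod_cast hn
      rw [hempty, measure_empty, ENNReal.log_zero, EReal.bot_div_of_pos_ne_top
        (by exact_mod_cast hn') (EReal.coe_ne_top _)]
      exact bot_le
    · have hbdd : BddBelow (F ∩ Ici 0) := ⟨0, fun x hx => hx.2⟩
      have hmem := (hF.inter isClosed_Ici).csInf_mem hne hbdd
      set a := sInf (F ∩ Ici 0)
      calc _ ≤ limsup (fun n : ℕ => ENNReal.log (P {ω | a ≤ S n ω / n}) / ((n : ℝ) : EReal))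
            atTop := by
            refine limsup_le_limsup (Eventually.of_forall fun n => ?_)
            refine log_measure_div_mono (fun ω hω => ?_) n
            exact csInf_le hbdd ⟨hω, hnn n ω⟩
        _ ≤ -legendre Λ a := limsup_upper_tail_le hS hb hΛ h0 hmem.2
        _ ≤ _ := EReal.neg_le_neg_iff.2 (iInf₂_le a hmem.1)
  lower_bound G hG := by
    rw [EReal.neg_le]
    refine le_iInf₂ fun x hx => ?_
    rw [EReal.neg_le]
    exact neg_legendre_le_liminf hS hb hΛ h0 hd0 hd hlow hG hx

/-- The rate function is monotone on the half-line, so it is continuous outside a countable set, and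
at its continuity points the upper and lower bounds for the tail agree. -/
theorem ae_tendsto_log_tail (hS : ∀ n, Measurable (S n))
    (hb : ∀ (n : ℕ) ω, S n ω ∈ Icc 0 (b * n))
    (hΛ : ∀ t, Tendsto (fun n : ℕ => cgf (S n) P t / n) atTop (𝓝 (Λ t)))
    (h0 : ∀ t ≤ 0, Λ t = 0) (hd0 : HasDerivAt Λ 0 0) (hd : ∀ t, ∃ d, HasDerivAt Λ d t) {C : ℝ}
    (hlow : ∀ t, b * t - C ≤ Λ t) :
    ∀ᵐ x : ℝ, 0 < x → Tendsto (fun n : ℕ =>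
      ENNReal.log (P {ω | x < S n ω / n}) / ((n : ℝ) : EReal)) atTop (𝓝 (-legendre Λ x)) := by
  have hc := (monotoneOn_legendre h0).countable_not_continuousWithinAt.ae_notMem volume
  filter_upwards [hc] with x hx hx0
  have hcont : ContinuousWithinAt (legendre Λ) (Ici 0) x := by
    by_contra h
    exact hx ⟨hx0.le, h⟩
  refine tendsto_of_le_liminf_of_limsup_le ?_ ?_
  · have hlim : Tendsto (fun y => -legendre Λ y) (𝓝[>] x) (𝓝 (-legendre Λ x)) :=
      (continuous_neg.tendsto _).comp
        (hcont.mono_left (nhdsWithin_mono _ fun y (hy : x < y) => (hx0.trans hy).le))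
    refine le_of_tendsto hlim ?_
    filter_upwards [self_mem_nhdsWithin] with y hy
    exact neg_legendre_le_liminf hS hb hΛ h0 hd0 hd hlow isOpen_Ioi hy
  · refine le_trans (limsup_le_limsup (Eventually.of_forall fun n => ?_))
      (limsup_upper_tail_le hS hb hΛ h0 hx0.le)
    refine log_measure_div_mono (fun ω hω => ?_) n
    have hω' : x < S n ω / n := hω
    exact hω'.le

end GartnerEllis

/-! ### The scaled cumulant generating functions of the block counts -/

lemma exists_abs_le_mul_add {a : ℕ → ℝ} (h : Tendsto (fun n : ℕ => a n / n) atTop (𝓝 0)) {δ : ℝ}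
    (hδ : 0 < δ) : ∃ C, ∀ n : ℕ, |a n| ≤ δ * n + C := by
  obtain ⟨N, hN⟩ := eventually_atTop.1 (Metric.tendsto_nhds.1 h δ hδ)
  refine ⟨∑ n ∈ Finset.range (N + 1), |a n|, fun n => ?_⟩
  have hsum : 0 ≤ ∑ n ∈ Finset.range (N + 1), |a n| := Finset.sum_nonneg fun _ _ => abs_nonneg _
  rcases Nat.lt_or_ge n (N + 1) with hn | hn
  · have := Finset.single_le_sum (f := fun n => |a n|) (fun _ _ => abs_nonneg _)
      (Finset.mem_range.2 hn)
    have : 0 ≤ δ * n := by positivity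
    linarith
  · have h1 := hN n (by omega)
    have hn' : (0 : ℝ) < n := by exact_mod_cast (by omega : 0 < n)
    rw [Real.dist_eq, sub_zero, abs_div, abs_of_pos hn', div_lt_iff₀ hn'] at h1
    linarith

lemma compSum_nonneg {p : ℕ → ℝ} (hp : ∀ k, 0 ≤ p k) (n : ℕ) {F : List ℕ → ℝ}
    (hF : ∀ L, 0 ≤ F L) : 0 ≤ compSum p n F := by
  have := compSum_mono hp n (F := fun L => 0 * F L) (G := F) fun L _ _ => by simpa using hF L
  rwa [compSum_const_mul, zero_mul] at this

lemma mul_singleton_le_compSum {p : ℕ → ℝ} (hp : ∀ k, 0 ≤ p k) (n : ℕ) {F : List ℕ → ℝ}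
    (hF : ∀ L, 0 ≤ F L) : p (n + 1) * F [n + 1] ≤ compSum p (n + 1) F := by
  rw [compSum_succ]
  have := Finset.single_le_sum
    (f := fun k => p (k + 1) * compSum p (n - k) (fun L => F ((k + 1) :: L)))
    (fun k _ => mul_nonneg (hp _) (compSum_nonneg hp _ fun L => hF _))
    (Finset.self_mem_range_succ n)
  simpa [compSum_zero] using this

lemma tendsto_log_stableWeight {α : ℝ} (hα : α ∈ Ioo (0 : ℝ) 1) :
    Tendsto (fun n : ℕ => Real.log (stableWeight α n) / n) atTop (𝓝 0) := by
  refine tendsto_log_div_of_ratio (stableWeight_pos hα) ?_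
  refine (tendsto_add_div_add (-α) 1).congr' ?_
  filter_upwards [eventually_ge_atTop 1] with n hn
  have h := stableWeight_succ α hn
  have h1 : (1 + n : ℝ) ≠ 0 := by positivity
  rw [div_eq_div_iff h1 (stableWeight_pos hα n).ne']
  linear_combination -h

/-- A factor depending subexponentially on the number of parts does not change the exponential
growth rate of a weighted sum over compositions. -/
lemma tendsto_log_compSum_length {p g : ℕ → ℝ} {F : List ℕ → ℝ} {y : ℝ} (hp : ∀ k, 0 ≤ p k)
    (hg : ∀ r, 0 < g r) (hglim : Tendsto (fun r : ℕ => Real.log (g r) / r) atTop (𝓝 0))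
    (hF : ∀ L, 0 ≤ F L) (hpos : ∀ n, 0 < compSum p n F)
    (h : Tendsto (fun n : ℕ => Real.log (compSum p n F) / n) atTop (𝓝 y)) :
    Tendsto (fun n : ℕ => Real.log (compSum p n fun L => g L.length * F L) / n) atTop (𝓝 y) := by
  suffices hdiff : Tendsto (fun n : ℕ => Real.log (compSum p n fun L => g L.length * F L) / n
      - Real.log (compSum p n F) / n) atTop (𝓝 0) by
    simpa using hdiff.add h
  rw [Metric.tendsto_nhds]
  intro ε hε
  obtain ⟨C, hC⟩ := exists_abs_le_mul_add hglim (half_pos hε)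
  have hC0 : 0 ≤ C := by simpa using (abs_nonneg _).trans (hC 0)
  have hsmall : Tendsto (fun n : ℕ => C / n) atTop (𝓝 0) :=
    tendsto_const_nhds.div_atTop tendsto_natCast_atTop_atTop
  filter_upwards [hsmall.eventually (gt_mem_nhds (half_pos hε)), eventually_gt_atTop 0]
    with n hn hn0
  have hn' : (0 : ℝ) < n := by exact_mod_cast hn0
  have hbound : ∀ r ≤ n, |Real.log (g r)| ≤ ε / 2 * n + C := fun r hr => (hC r).trans (by gcongr)
  have hup : compSum p n (fun L => g L.length * F L)
      ≤ Real.exp (ε / 2 * n + C) * compSum p n F := by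
    rw [← compSum_const_mul]
    refine compSum_mono hp n fun L _ hL => mul_le_mul_of_nonneg_right ?_ (hF L)
    rw [← Real.exp_log (hg L.length)]
    exact Real.exp_le_exp.2 (abs_le.1 (hbound _ hL)).2
  have hlow : Real.exp (-(ε / 2 * n + C)) * compSum p n F
      ≤ compSum p n (fun L => g L.length * F L) := by
    rw [← compSum_const_mul]
    refine compSum_mono hp n fun L _ hL => mul_le_mul_of_nonneg_right ?_ (hF L)
    rw [← Real.exp_log (hg L.length)]
    exact Real.exp_le_exp.2 (abs_le.1 (hbound _ hL)).1
  have hlow0 := mul_pos (Real.exp_pos (-(ε / 2 * n + C))) (hpos n)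
  have h1 := Real.log_le_log (hlow0.trans_le hlow) hup
  have h2 := Real.log_le_log hlow0 hlow
  rw [Real.log_mul (Real.exp_pos _).ne' (hpos n).ne', Real.log_exp] at h1 h2
  rw [Real.dist_eq, sub_zero, ← sub_div, abs_div, abs_of_pos hn', div_lt_iff₀ hn', abs_lt]
  rw [div_lt_iff₀ hn'] at hn
  constructor <;> linarith

lemma numBlocks_eq_count {𝕏 Ω : Type*} (X : ℕ → Ω → 𝕏) (l n : ℕ) (ω : Ω) :
    numBlocks X l n ω = (blockSizes fun i : Fin n => X i ω).count l :=
  blockCount_eq_count l _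

lemma numBlocks_mem_Icc {𝕏 Ω : Type*} (X : ℕ → Ω → 𝕏) {l : ℕ} (hl : 1 ≤ l) (n : ℕ) (ω : Ω) :
    (numBlocks X l n ω : ℝ) ∈ Icc (0 : ℝ) (1 / l * n) := by
  have hl' : (0 : ℝ) < l := by exact_mod_cast hl
  refine ⟨Nat.cast_nonneg _, ?_⟩
  rw [one_div_mul_eq_div, le_div_iff₀ hl', mul_comm]
  exact_mod_cast mul_blockCount_le l fun i : Fin n => X i ω

section numBlocks

variable {𝕏 : Type*} [MeasurableSpace 𝕏] [MeasurableEq 𝕏]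
  {Ω : Type*} [MeasurableSpace Ω] {α θ : ℝ} {ν : Measure 𝕏}
  {P : Measure Ω} {X : ℕ → Ω → 𝕏}

lemma IsEwensPitmanSequence.measurable_numBlocks (hX : IsEwensPitmanSequence α θ ν P X)
    (l n : ℕ) : Measurable fun ω => (numBlocks X l n ω : ℝ) := by
  simp only [numBlocks_eq_count]
  exact (measurable_comp_blockSizes fun S => (S.count l : ℝ)).comp
    (measurable_pi_lambda _ fun i : Fin n => hX.measurable i)

variable [MeasurableSingletonClass 𝕏] [IsProbabilityMeasure ν] [NullSingletonClass ν]
  [IsProbabilityMeasure P]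

lemma IsEwensPitmanSequence.totalWeight_mul_mgf (hα : α ∈ Ioo (0 : ℝ) 1) (hθ : -α < θ)
    (hX : IsEwensPitmanSequence α θ ν P X) (l n : ℕ) (t : ℝ) :
    totalWeight θ (n + 1) * mgf (fun ω => (numBlocks X l (n + 1) ω : ℝ)) P t
      = compSum (stableWeight α) (n + 1)
        fun L => blockNumberWeight α θ L.length * Real.exp t ^ L.count l := by
  have h := hX.totalWeight_mul_integral hα hθ n fun S => Real.exp t ^ S.count l
  simp only [Multiset.coe_count] at h
  rw [← h, mgf]
  simp only [numBlocks_eq_count, ← Real.exp_nat_mul, mul_comm t]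

theorem IsEwensPitmanSequence.tendsto_cgf_numBlocks (hα : α ∈ Ioo (0 : ℝ) 1) (hθ : -α < θ)
    (hX : IsEwensPitmanSequence α θ ν P X) {l : ℕ} (hl : 1 ≤ l) (t : ℝ) :
    Tendsto (fun n : ℕ => cgf (fun ω => (numBlocks X l n ω : ℝ)) P t / n) atTop
      (𝓝 (limitCgf α l t)) := by
  have hp := stableWeight_pos hα
  have hg := blockNumberWeight_pos hα.1 hθ
  have hθ1 : -1 < θ := by linarith [hα.2]
  have hw := totalWeight_pos hθ1
  have hint : ∀ n, Integrable (fun ω => Real.exp (t * numBlocks X l n ω)) P := fun n =>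
    integrable_exp_mul_of_bounded (hX.measurable_numBlocks l n) (numBlocks_mem_Icc X hl n) t
  have hW := tendsto_log_totalWeight hθ1
  have hcgf : ∀ n : ℕ, cgf (fun ω => (numBlocks X l (n + 1) ω : ℝ)) P t
      = Real.log (compSum (stableWeight α) (n + 1)
          fun L => blockNumberWeight α θ L.length * Real.exp t ^ L.count l)
        - Real.log (totalWeight θ (n + 1)) := by
    intro n
    rw [← hX.totalWeight_mul_mgf hα hθ l n t,
      Real.log_mul (hw _).ne' (mgf_pos (hint _)).ne', cgf]
    ring
  rw [← tendsto_add_atTop_iff_nat 1]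
  simp only [hcgf, sub_div]
  rcases le_or_gt t 0 with ht | ht
  · -- a single block of size `n` has subexponentially small probability
    rw [limitCgf_of_nonpos ht]
    have hlow : Tendsto (fun n : ℕ => Real.log (stableWeight α n) / n
        + Real.log (1 / α * Real.exp t) / n - Real.log (totalWeight θ n) / n) atTop (𝓝 0) := by
      have := ((tendsto_log_stableWeight hα).add (tendsto_const_nhds (x :=
        Real.log (1 / α * Real.exp t)).div_atTop tendsto_natCast_atTop_atTop)).sub hW
      simpa using this
    refine tendsto_of_tendsto_of_tendsto_of_le_of_le
      ((tendsto_add_atTop_iff_nat 1).2 hlow) tendsto_const_nhds (fun n => ?_) fun n => ?_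
    · have hn : (0 : ℝ) < (n + 1 : ℕ) := by positivity
      have h1 := mul_singleton_le_compSum (fun k => (hp k).le) n (F := fun L =>
        blockNumberWeight α θ L.length * Real.exp t ^ L.count l)
        fun L => mul_nonneg (hg _).le (by positivity)
      have h2 : Real.exp t ≤ Real.exp t ^ [n + 1].count l := by
        conv_lhs => rw [← pow_one (Real.exp t)]
        exact pow_le_pow_of_le_one (Real.exp_pos t).le (Real.exp_le_one_iff.2 ht)
          List.count_le_length
      have h3 : 0 < 1 / α * Real.exp t := mul_pos (one_div_pos.2 hα.1) (Real.exp_pos t)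
      have h4 : stableWeight α (n + 1) * (1 / α * Real.exp t) ≤ stableWeight α (n + 1)
          * (blockNumberWeight α θ [n + 1].length * Real.exp t ^ [n + 1].count l) :=
        mul_le_mul_of_nonneg_left
          (mul_le_mul_of_nonneg_left h2 (one_div_pos.2 hα.1).le) (hp _).le
      have h5 := Real.log_le_log (mul_pos (hp (n + 1)) h3) (h4.trans h1)
      rw [Real.log_mul (hp _).ne' h3.ne'] at h5
      simp only [← add_div, ← sub_div]
      gcongr
    · rw [← sub_div, ← hcgf]
      refine div_nonpos_of_nonpos_of_nonneg ?_ (by positivity)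
      refine Real.log_nonpos mgf_nonneg ?_
      have h := integral_mono (hint (n + 1)) (integrable_const (μ := P) (1 : ℝ)) fun ω =>
        Real.exp_le_one_iff.2 (mul_nonpos_of_nonpos_of_nonneg ht
          (Nat.cast_nonneg (α := ℝ) (numBlocks X l (n + 1) ω)))
      simpa [mgf] using h
  · have hu := tendsto_log_compSum_count hα hl (Real.exp_pos t) (limitCgf_spec hα hl ht).1
      (limitCgf_equation hα hl ht)
    have hmid := tendsto_log_compSum_length (fun k => (hp k).le) hg
      (tendsto_log_blockNumberWeight hα.1 hθ) (fun L => by positivity) (fun n => ?_) hu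
    · have := (hmid.sub hW)
      rw [sub_zero] at this
      exact (tendsto_add_atTop_iff_nat 1).2 this
    · cases n with
      | zero => simp [compSum_zero]
      | succ n =>
        exact (mul_pos (hp _) (by positivity)).trans_le
          (mul_singleton_le_compSum (fun k => (hp k).le) n fun L => by positivity)

end numBlocks

/-! ### The large deviation principle for the block counts -/

theorem theorem1 {𝕏 : Type*} [TopologicalSpace 𝕏] [PolishSpace 𝕏] [MeasurableSpace 𝕏]
    [BorelSpace 𝕏] (ν : Measure 𝕏) [IsProbabilityMeasure ν] [NullSingletonClass ν]
    {Ω : Type*} [MeasurableSpace Ω] (P : Measure Ω) [IsProbabilityMeasure P]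
    (α θ : ℝ) (hα : α ∈ Ioo (0 : ℝ) 1) (hθ : -α < θ)
    (X : ℕ → Ω → 𝕏) (hX : IsEwensPitmanSequence α θ ν P X)
    (l : ℕ) (hl : 1 ≤ l) :
    -- the inverse function in the definition of the limit is well defined
    BijOn (ewensH₂ α l) (Ioo (0 : ℝ) (1 / l)) univ ∧
    -- it is the limit of the scaled cumulant generating functions
    (∀ t : ℝ, Tendsto (fun n : ℕ => cgf (fun ω => (numBlocks X l n ω : ℝ)) P t / n) atTop
      (𝓝 (limitCgf α l t))) ∧
    -- the large deviation principle
    IsGoodRateFunction (rateFunction α l) ∧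
    SatisfiesLDP P (fun n ω => (numBlocks X l n ω : ℝ) / n) (fun n => (n : ℝ))
      (rateFunction α l) ∧
    -- the values of the rate function
    rateFunction α l 0 = 0 ∧
    (∀ x ∈ Ioc (0 : ℝ) (1 / l), rateFunction α l x < ⊤) ∧
    (∀ x ∉ Icc (0 : ℝ) (1 / l), rateFunction α l x = ⊤) ∧
    -- the tail asymptotics
    (∀ᵐ x : ℝ, 0 < x →
      Tendsto (fun n : ℕ =>
          ENNReal.log (P {ω | x < (numBlocks X l n ω : ℝ) / n}) / ((n : ℝ) : EReal)) atTop
        (𝓝 (-rateFunction α l x))) := by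
  have hrate : rateFunction α l = legendre (limitCgf α l) := rfl
  have hS := fun n => hX.measurable_numBlocks l n
  have hb := numBlocks_mem_Icc X hl
  have hΛ := hX.tendsto_cgf_numBlocks hα hθ hl
  have h0 : ∀ t ≤ 0, limitCgf α l t = 0 := fun t ht => limitCgf_of_nonpos ht
  have hup : ∀ t, 0 ≤ t → limitCgf α l t ≤ 1 / l * t := fun t ht => cgf_limit_le hS hb hΛ ht
  have hd0 := hasDerivAt_limitCgf_zero hα hl
  have hd := exists_hasDerivAt_limitCgf hα hl
  obtain ⟨C, hC⟩ := exists_le_limitCgf hα hl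
  rw [hrate]
  refine ⟨bijOn_ewensH₂ hα.1 hl, hΛ, isGoodRateFunction_legendre h0 hup,
    satisfiesLDP_legendre hS hb hΛ h0 hd0 hd hC,
    legendre_zero (h0 0 le_rfl) (limitCgf_nonneg hα hl),
    fun x hx => legendre_lt_top h0 hC ⟨hx.1.le, hx.2⟩, fun x hx => ?_,
    ae_tendsto_log_tail hS hb hΛ h0 hd0 hd hC⟩
  rcases lt_or_ge x 0 with h | h
  · exact legendre_eq_top_of_neg h0 h
  · exact legendre_eq_top_of_lt hup (not_le.1 fun h' => hx ⟨h, h'⟩)
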